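/- Let $q$ be even, let $K$ be the finite field with $q$ elements, and let $\mathrm{PG}(4,q)$ be the projective space of $V=K^5$; its points, planes and solids are the vector subspaces of $V$ of dimension $1$, $3$ and $4$. Let $\mathcal H$ be a non-empty set of solids of $\mathrm{PG}(4,q)$ such that (I) every point of $\mathrm{PG}(4,q)$ lies in either $0$, $\tfrac12q^3$ or $\tfrac12(q^3+q^2)$ solids of $\mathcal H$, and (II) every plane which is contained in a solid of $\mathcal H$ is contained in at least $\tfrac12q$ solids of $\mathcal H$. Then the set $\mathcal Q$ of points contained in exactly $\tfrac12(q^3+q^2)$ solids of $\mathcal H$ is a non-singular quadric $Q(4,q)$, that is, the set of points at which some quadratic form $f$ on $V$ vanishes, where $f$ is non-singular: no non-zero $v\in V$ satisfies both $f(v)=0$ and $f(v+w)=f(v)+f(w)$ for all $w\in V$. Moreover, $\mathcal H$ is the set of all solids $\Sigma$ such that $\mathcal Q\cap\Sigma$ is a hyperbolic quadric $Q^+(3,q)$ of $\Sigma$, that is, the set of points of $\Sigma$ satisfying $x_0x_1+x_2x_3=0$ in suitable linear coordinates $x_0,x_1,x_2,x_3$ on $\Sigma$. -/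

import Mathlib

open scoped LinearAlgebra.Projectivization

/-- The underlying vector space of `PG(4,q)`, where `K` is the field with `q` elements. The points
of `PG(4,q)` are the elements of `ℙ K (PG4Space K)`. -/
abbrev PG4Space (K : Type*) : Type _ := Fin 5 → K

/-- A plane of `PG(4,q)`: a vector subspace of dimension three. -/
def IsPlane {K : Type*} [Field K] (π : Submodule K (PG4Space K)) : Prop :=
  Module.finrank K π = 3

/-- A solid (hyperplane) of `PG(4,q)`: a vector subspace of dimension four. -/
def IsSolid {K : Type*} [Field K] (S : Submodule K (PG4Space K)) : Prop :=
  Module.finrank K S = 4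

/-- The number of members of `H` that contain the subspace `U`. For a point `P`, take
`U = P.submodule`. -/
noncomputable def numContaining {K : Type*} [Field K] (H : Set (Submodule K (PG4Space K)))
    (U : Submodule K (PG4Space K)) : ℕ :=
  Set.ncard {S | S ∈ H ∧ U ≤ S}

/-- The set of points of the projective space of `W` at which the quadratic form `Q` vanishes. -/
def quadricPoints {K W : Type*} [Field K] [AddCommGroup W] [Module K W]
    (Q : QuadraticForm K W) : Set (ℙ K W) :=
  {P | Q P.rep = 0}

/-- Membership in the quadric does not depend on the choice of a representative. -/
theorem mk_mem_quadricPoints {K W : Type*} [Field K] [AddCommGroup W] [Module K W]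
    (Q : QuadraticForm K W) (v : W) (hv : v ≠ 0) :
    Projectivization.mk K v hv ∈ quadricPoints Q ↔ Q v = 0 := by
  obtain ⟨a, ha⟩ := Projectivization.exists_smul_eq_mk_rep K v hv
  simp [quadricPoints, ← ha, Units.smul_def, QuadraticMap.map_smul]

/-- A quadratic form is non-singular if no non-zero singular vector is orthogonal to the whole
space with respect to the polar form (in characteristic two the polar form itself may be
degenerate; its radical then contains no non-zero singular vector). -/
def IsNonsingularForm {K W : Type*} [Field K] [AddCommGroup W] [Module K W]
    (Q : QuadraticForm K W) : Prop :=
  ∀ v : W, Q v = 0 → (∀ w : W, QuadraticMap.polar Q v w = 0) → v = 0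

/-- A set of points is a non-singular quadric if it is the zero set of a non-singular quadratic
form. For `W = PG4Space K`, `K` finite, these are the quadrics `Q(4,q)`. -/
def IsNonsingularQuadric {K W : Type*} [Field K] [AddCommGroup W] [Module K W]
    (A : Set (ℙ K W)) : Prop :=
  ∃ Q : QuadraticForm K W, IsNonsingularForm Q ∧ A = quadricPoints Q

/-- The canonical hyperbolic form `x₀ x₁ + x₂ x₃` in four variables. -/
def hyperbolicForm (K : Type*) [Field K] : QuadraticForm K (Fin 4 → K) :=
  QuadraticMap.proj 0 1 + QuadraticMap.proj 2 3

/-- A set of points is a hyperbolic quadric `Q⁺(3,q)` if, in suitable coordinates, it is the zero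
set of `x₀ x₁ + x₂ x₃`. -/
def IsHyperbolicQuadric {K W : Type*} [Field K] [AddCommGroup W] [Module K W]
    (A : Set (ℙ K W)) : Prop :=
  ∃ Q : QuadraticForm K W, Q.Equivalent (hyperbolicForm K) ∧ A = quadricPoints Q

/-- The intersection of a set `A` of points of the projective space of `W` with a subspace `S`,
as a set of points of the projective space of `S`. -/
def sectionBy {K W : Type*} [Field K] [AddCommGroup W] [Module K W]
    (A : Set (ℙ K W)) (S : Submodule K W) : Set (ℙ K S) :=
  Projectivization.map S.subtype S.injective_subtype ⁻¹' A

/-!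
Let `h v` be the number of solids of `H` through the point of a vector `v`.

*The nucleus.* Counting incidences of vectors with solids and with pairs of solids determines the
first two moments of `h`. Together with `q` being a power of two and the numbers of points of each
kind being non-negative integers, this forces `|H| = q² (q² + 1) / 2` and yields a point `N` on no
solid of `H` (`standard_equations`, `card_solids`).

*The affine model.* Split `V = K N ⊕ U`. The solids not through `N` are the graphs `{x u • N + u}`
of the linear forms `x` on `U`, so `H` becomes a set `X` of points of the affine space `Dual K U =
AG(4,q)`. The points of `V` off `N` become its hyperplanes `{x | x u = c}`, and the planes not on
`N` become its lines. The sizes `q³/2`, `(q³ + q²)/2` of the hyperplane sections add up to `|X|`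
over a parallel class, so each class contains exactly one large hyperplane, say `{x | x u = φ u}`.
Thus the required quadric is the graph of `φ`. This is the situation of `IsTwoIntersectionSet`.

*Lines.* For a point `x` of `X`, the sum of the squares of the hyperplane sections through `x`
counts the pairs of points of `X` collinear with `x`. It follows that the numbers `l` of points on
the lines through `x` satisfy `∑ (2 l - q) (q - l) = 0`. The hypothesis that a plane on one solid of
`H` is on at least `q/2` of them makes every term non-negative, so every line meets `X` in `0`,
`q/2` or `q` points (`two_mul_lineCount_of_mem`).

*Cylinders.* In a large hyperplane, a point outside `X` is then on a unique line missing `X`, and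
these lines are all parallel (`lineCount_eq_zero_of_parallel`), so that `X` meets the hyperplane in
a cylinder, with direction `d` say. Planes inside `X` correspond to the lines of the projective
space of `U` on which `φ` is linear (`isLinearOn_of_plane_subset`, `plane_subset_of_isLinearOn`),
and the cylinder shows that those through the point of `u` are the lines of the plane `d v = 0`
(`isLinearOn_iff`).

*The quadratic form.* Linearity of `φ` on the span of two vectors is therefore an orthogonality
relation with a symplectic frame `e, f, e', f'`, which can be scaled such that `e + s e'` is
orthogonal to `s f + f'` for all `s` (`exists_scaled_frame`). These relations are a functional
equation which says that, up to a linear function, `φ` is `C √(a b + c d)` in the coordinates of the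
frame (`sq_apply_frame`). So `φ²` is a quadratic form `G` with non-degenerate polar form, and the
graph of `φ` is the zero set of the non-singular form `t² + G u`.

*The solids of `H`.* A point of `X` lies on a plane contained in `X` (`exists_isLinearOn_of_mem`),
that is, a solid of `H` contains a line of the quadric; as the polar form restricted to the solid is
non-degenerate, the section is hyperbolic. Conversely, a hyperbolic section contains a line of the
quadric, and its solid does not contain `N`, so it belongs to `H`.
-/

/-! ### Counting solutions of linear equations and points on lines -/

section

open Finset Module
open scoped Classical

section Counting

theorem card_fiber_mul_card {K E F : Type*} [Field K] [AddCommGroup E] [Module K E]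
    [AddCommGroup F] [Module K F] [Fintype E] [Fintype F] (f : E →ₗ[K] F)
    (hf : Function.Surjective f) (y : F) (p : E → Prop) [DecidablePred p]
    (hp : ∀ x, p x ↔ f x = y) : #{x | p x} * Fintype.card F = Fintype.card E := by
  have h : ∀ z : F, #{x | f x = z} = #{x | p x} := by
    intro z
    obtain ⟨b, hb⟩ := hf y
    obtain ⟨c, hc⟩ := hf z
    refine Finset.card_bij (fun x _ => x - c + b) ?_ ?_ ?_
    · intro x hx
      simp only [Finset.mem_filter, Finset.mem_univ, true_and] at hx ⊢
      simp [hx, hb, hc, hp]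
    · intro x _ x' _ hxx
      simpa using hxx
    · intro x hx
      simp only [Finset.mem_filter, Finset.mem_univ, true_and, hp] at hx
      refine ⟨x - b + c, ?_, by abel⟩
      simp [hx, hb, hc]
  have := Finset.card_eq_sum_card_fiberwise (f := f) (s := Finset.univ) (t := Finset.univ)
    (by simp)
  rw [Finset.card_univ] at this
  rw [this, Finset.sum_congr rfl (fun z _ => h z)]
  simp [mul_comm]

theorem exists_dual_eq_pair {K U : Type*} [Field K] [AddCommGroup U] [Module K U] {u v : U}
    (h : LinearIndependent K ![u, v]) (a b : K) : ∃ x : Dual K U, x u = a ∧ x v = b := by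
  obtain ⟨g, hg⟩ := LinearMap.exists_leftInverse_of_injective
    (Fintype.linearCombination K ![u, v])
    (LinearMap.ker_eq_bot.2 (by simpa [Fintype.linearCombination] using
      (linearIndependent_iff_injective_fintypeLinearCombination).1 h))
  have hu : g u = Pi.single 0 1 := by
    have := LinearMap.congr_fun hg (Pi.single 0 1)
    simpa [Fintype.linearCombination_apply, Fin.sum_univ_two] using this
  have hv : g v = Pi.single 1 1 := by
    have := LinearMap.congr_fun hg (Pi.single 1 1)
    simpa [Fintype.linearCombination_apply, Fin.sum_univ_two] using this
  refine ⟨(a • LinearMap.proj 0 + b • LinearMap.proj 1 : (Fin 2 → K) →ₗ[K] K) ∘ₗ g, ?_, ?_⟩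
  · simp [hu]
  · simp [hv]

theorem exists_apply_eq_pair {K W : Type*} [Field K] [AddCommGroup W] [Module K W]
    [FiniteDimensional K W] {y z : Dual K W} (h : LinearIndependent K ![y, z]) (a b : K) :
    ∃ w, y w = a ∧ z w = b := by
  obtain ⟨x, h1, h2⟩ := exists_dual_eq_pair h a b
  obtain ⟨w, rfl⟩ := (Module.evalEquiv K W).surjective x
  exact ⟨w, by simpa using h1, by simpa using h2⟩

theorem exists_dual_eq {K U : Type*} [Field K] [AddCommGroup U] [Module K U] {u : U}
    (h : u ≠ 0) (a : K) : ∃ x : Dual K U, x u = a := by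
  have : ∃ x : Dual K U, x u ≠ 0 := by
    by_contra! hx
    exact h ((Module.forall_dual_apply_eq_zero_iff K u).1 hx)
  obtain ⟨x, hx⟩ := this
  exact ⟨(a / x u) • x, by simp [hx]⟩

variable {K U : Type*} [Field K] [AddCommGroup U] [Module K U] [Fintype K]

theorem card_of_finrank_four [Fintype U] (hU : finrank K U = 4) :
    Fintype.card U = Fintype.card K ^ 4 := by
  rw [Module.card_eq_pow_finrank (K := K), hU]

theorem card_dual [Fintype (Dual K U)] (hU : finrank K U = 4) :
    Fintype.card (Dual K U) = Fintype.card K ^ 4 := by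
  rw [Module.card_eq_pow_finrank (K := K), Subspace.dual_finrank_eq, hU]

theorem card_dual_apply_eq [Fintype (Dual K U)] (hU : finrank K U = 4) {u : U} (hu : u ≠ 0)
    (c : K) : #{x : Dual K U | x u = c} = Fintype.card K ^ 3 := by
  have h := card_fiber_mul_card (Dual.eval K U u) (fun a => exists_dual_eq hu a) c
    (fun x => x u = c) (fun x => by simp)
  rw [card_dual hU] at h
  exact Nat.eq_of_mul_eq_mul_right (Fintype.card_pos (α := K)) (by rw [h]; ring)

theorem card_dual_apply_eq_pair [Fintype (Dual K U)] (hU : finrank K U = 4) {u v : U}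
    (huv : LinearIndependent K ![u, v]) (a b : K) :
    #{x : Dual K U | x u = a ∧ x v = b} = Fintype.card K ^ 2 := by
  have h := card_fiber_mul_card ((Dual.eval K U u).prod (Dual.eval K U v))
    (fun y => by
      obtain ⟨x, h1, h2⟩ := exists_dual_eq_pair huv y.1 y.2
      exact ⟨x, by ext <;> simp [h1, h2]⟩) (a, b) (fun x => x u = a ∧ x v = b)
    (fun x => by simp [Prod.ext_iff])
  rw [card_dual hU, Fintype.card_prod] at h
  have hq : 0 < Fintype.card K := Fintype.card_pos
  exact Nat.eq_of_mul_eq_mul_right (Nat.mul_pos hq hq) (by rw [h]; ring)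

theorem card_ker_dual [Fintype U] (hU : finrank K U = 4) {y : Dual K U} (hy : y ≠ 0) :
    #{u : U | y u = 0} = Fintype.card K ^ 3 := by
  have h := card_fiber_mul_card y (LinearMap.surjective hy) 0 (fun u => y u = 0) (fun _ => Iff.rfl)
  rw [card_of_finrank_four hU] at h
  exact Nat.eq_of_mul_eq_mul_right (Fintype.card_pos (α := K)) (by rw [h]; ring)

theorem card_ker_dual_pair [Fintype U] (hU : finrank K U = 4) {y z : Dual K U}
    (hyz : LinearIndependent K ![y, z]) :
    #{u : U | y u = 0 ∧ z u = 0} = Fintype.card K ^ 2 := by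
  have : FiniteDimensional K U := Module.Finite.of_finite
  have h := card_fiber_mul_card (y.prod z)
    (fun p => by
      obtain ⟨u, h1, h2⟩ := exists_apply_eq_pair hyz p.1 p.2
      exact ⟨u, by ext <;> simp [h1, h2]⟩) (0, 0) (fun u => y u = 0 ∧ z u = 0)
    (fun x => by simp [Prod.ext_iff])
  rw [card_of_finrank_four hU, Fintype.card_prod] at h
  have hq : 0 < Fintype.card K := Fintype.card_pos
  exact Nat.eq_of_mul_eq_mul_right (Nat.mul_pos hq hq) (by rw [h]; ring)

end Counting

section Lines

variable {K E : Type*} [Field K] [Fintype K] [AddCommGroup E] [Module K E]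

variable (K) in
/-- The number of parameters `t` for which `x + t • d` lies in `X`. For `d ≠ 0` this is the number
of points of `X` on the affine line through `x` with direction `d`. -/
noncomputable def lineCount (X : Finset E) (x d : E) : ℕ := #{t : K | x + t • d ∈ X}

theorem lineCount_add_smul (X : Finset E) (x d : E) (s : K) :
    lineCount K X (x + s • d) d = lineCount K X x d := by
  refine Finset.card_bij (fun t _ => s + t) ?_ (fun _ _ _ _ h => by simpa using h) ?_
  · intro t ht
    simpa [add_smul, add_assoc] using ht
  · intro t ht
    refine ⟨t - s, ?_, by ring⟩
    simp only [Finset.mem_filter, Finset.mem_univ, true_and] at ht ⊢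
    rwa [add_assoc, ← add_smul, add_sub_cancel]

theorem lineCount_smul (X : Finset E) (x d : E) {s : K} (hs : s ≠ 0) :
    lineCount K X x (s • d) = lineCount K X x d := by
  refine Finset.card_bij (fun t _ => t * s) ?_ (fun _ _ _ _ h => by simpa [hs] using h) ?_
  · intro t ht
    simpa [mul_smul] using ht
  · intro t ht
    refine ⟨t / s, ?_, by field_simp⟩
    simp only [Finset.mem_filter, Finset.mem_univ, true_and] at ht ⊢
    rwa [← mul_smul, div_mul_cancel₀ _ hs]

theorem lineCount_eq_zero_iff (X : Finset E) (x d : E) :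
    lineCount K X x d = 0 ↔ ∀ t : K, x + t • d ∉ X := by
  simp [lineCount, Finset.filter_eq_empty_iff]

theorem lineCount_eq_card_iff (X : Finset E) (x d : E) :
    lineCount K X x d = Fintype.card K ↔ ∀ t : K, x + t • d ∈ X := by
  simp [lineCount, ← Finset.card_univ, Finset.card_filter_eq_iff]

theorem lineCount_le (X : Finset E) (x d : E) : lineCount K X x d ≤ Fintype.card K :=
  Finset.card_le_univ _

/-- Each point of `X` other than `x` lies on exactly one line through `x`, and each line has `q - 1`
non-zero direction vectors `d`. -/
theorem sum_lineCount_mul [Fintype E] [DecidableEq E] (X : Finset E) (x : E) (g : E → ℤ)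
    (hg : ∀ t : K, t ≠ 0 → ∀ d, g (t • d) = g d) :
    ∑ d ∈ univ.erase 0, (lineCount K X x d : ℤ) * g d =
      (if x ∈ X then ∑ d ∈ univ.erase 0, g d else 0) +
        ((Fintype.card K : ℤ) - 1) * ∑ y ∈ X.erase x, g (y - x) := by
  have h1 : ∀ d, (lineCount K X x d : ℤ) * g d = ∑ t : K, if x + t • d ∈ X then g d else 0 := by
    intro d
    simp only [lineCount, Finset.sum_ite, Finset.sum_const, nsmul_eq_mul, mul_zero, add_zero]
    congr
  have h2 : ∀ t : K, t ≠ 0 → (∑ d ∈ univ.erase (0 : E), if x + t • d ∈ X then g d else 0) =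
      ∑ y ∈ X.erase x, g (y - x) := by
    intro t ht
    rw [← Finset.sum_filter]
    refine Finset.sum_bij (fun d _ => x + t • d) ?_ ?_ ?_ ?_
    · intro d hd
      simp only [Finset.mem_filter, Finset.mem_erase, Finset.mem_univ, and_true] at hd ⊢
      simpa [ht] using hd
    · intro d _ d' _ h
      simpa [ht] using h
    · intro y hy
      simp only [Finset.mem_erase] at hy
      refine ⟨t⁻¹ • (y - x), ?_, ?_⟩
      · simp [ht, sub_eq_zero, hy, smul_smul]
      · simp [ht, smul_smul]
    · intro d _
      simp [hg t ht]
  rw [Finset.sum_congr rfl (fun d _ => h1 d), Finset.sum_comm,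
    ← Finset.add_sum_erase _ _ (Finset.mem_univ (0 : K)),
    Finset.sum_congr rfl (fun t ht => h2 t (Finset.ne_of_mem_erase ht))]
  congr 1
  · by_cases hx : x ∈ X <;> simp [hx]
  · simp [Finset.card_erase_of_mem, Nat.cast_sub (Fintype.card_pos (α := K))]

end Lines

end

/-! ### Affine sets with two hyperplane sizes -/

section

open Finset Module
open scoped Classical

section AffineSet

variable {K U : Type*} [Field K] [Fintype K] [AddCommGroup U] [Module K U] [Fintype U]

/-- A set `X` of points of the affine space `Dual K U ≅ AG(4,q)`, whose affine hyperplanes are the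
sets `{x | x u = c}` with `u ≠ 0`. In each parallel class exactly one hyperplane, the one with
`c = φ u`, meets `X` in `(q³ + q²) / 2` points, and all others meet it in `q³ / 2` points; a line
that meets `X` does so in at least `q / 2` points. The value `φ 0`, which has no geometric meaning,
is set to zero to make `φ` homogeneous. -/
structure IsTwoIntersectionSet (X : Finset (Dual K U)) (φ : U → K) : Prop where
  finrank_eq : finrank K U = 4
  card_eq : 2 * #X = Fintype.card K ^ 4 + Fintype.card K ^ 2
  card_apply_eq : ∀ u ≠ 0, ∀ c, 2 * #{x ∈ X | x u = c} =
    if c = φ u then Fintype.card K ^ 3 + Fintype.card K ^ 2 else Fintype.card K ^ 3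
  le_lineCount : ∀ x ∈ X, ∀ d ≠ 0, Fintype.card K ≤ 2 * lineCount K X x d
  map_zero : φ 0 = 0

theorem sum_card_apply_eq (hU : finrank K U = 4) (X : Finset (Dual K U)) {x : Dual K U}
    (hx : x ∈ X) :
    ∑ u : U, #{y ∈ X | y u = x u} = Fintype.card K ^ 4 + (#X - 1) * Fintype.card K ^ 3 := by
  simp_rw [Finset.card_filter]
  rw [Finset.sum_comm]
  simp_rw [← Finset.card_filter]
  rw [← Finset.add_sum_erase _ _ hx]
  have h : ∀ y ∈ X.erase x, #{u : U | y u = x u} = Fintype.card K ^ 3 := by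
    intro y hy
    rw [← card_ker_dual hU (sub_ne_zero.2 (Finset.ne_of_mem_erase hy))]
    simp [sub_eq_zero]
  rw [Finset.sum_congr rfl h]
  simp [Finset.card_erase_of_mem hx, card_of_finrank_four hU]

theorem card_agree_pair (hU : finrank K U = 4) {x y z : Dual K U} (hy : y ≠ x) :
    #{u : U | y u = x u ∧ z u = x u} =
      if ∃ t : K, x + t • (y - x) = z then Fintype.card K ^ 3 else Fintype.card K ^ 2 := by
  have hy' := sub_ne_zero.2 hy
  split_ifs with h
  · obtain ⟨t, rfl⟩ := h
    rw [← card_ker_dual hU hy']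
    congr 1
    ext u
    simp +contextual [sub_eq_zero]
  · have : LinearIndependent K ![y - x, z - x] := by
      rw [LinearIndependent.pair_iff' hy']
      intro a ha
      exact h ⟨a, by rw [ha]; abel⟩
    rw [← card_ker_dual_pair hU this]
    simp [sub_eq_zero]

theorem card_mem_line (X : Finset (Dual K U)) {x y : Dual K U} (hy : y ≠ x) :
    #{z ∈ X | ∃ t : K, x + t • (y - x) = z} = lineCount K X x (y - x) := by
  symm
  refine Finset.card_bij (fun t _ => x + t • (y - x)) ?_ ?_ ?_
  · intro t ht
    simpa using ht
  · intro t _ s _ h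
    exact smul_left_injective K (sub_ne_zero.2 hy) (add_left_cancel h)
  · intro z hz
    obtain ⟨hz, t, rfl⟩ := Finset.mem_filter.1 hz
    exact ⟨t, by simpa using hz, rfl⟩

theorem sum_card_apply_eq_sq (hU : finrank K U = 4) (X : Finset (Dual K U)) {x : Dual K U}
    (hx : x ∈ X) :
    (∑ u : U, (#{y ∈ X | y u = x u} : ℤ) ^ 2) =
      (Fintype.card K : ℤ) ^ 4 + (#X - 1) * (Fintype.card K : ℤ) ^ 3 +
      (#X - 1) * #X * (Fintype.card K : ℤ) ^ 2 +
      ((Fintype.card K : ℤ) ^ 3 - (Fintype.card K : ℤ) ^ 2) *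
        ∑ y ∈ X.erase x, (lineCount K X x (y - x) : ℤ) := by
  have h1 : ∀ u : U, (#{y ∈ X | y u = x u} : ℤ) ^ 2 =
      ∑ y ∈ X, ∑ z ∈ X, if y u = x u ∧ z u = x u then 1 else 0 := by
    intro u
    rw [sq, Finset.card_filter]
    push_cast
    rw [Finset.sum_mul_sum]
    refine Finset.sum_congr rfl fun y _ => Finset.sum_congr rfl fun z _ => ?_
    split_ifs <;> simp_all
  have h2 : (∑ u : U, (#{y ∈ X | y u = x u} : ℤ) ^ 2) =
      ∑ y ∈ X, ∑ z ∈ X, (#{u : U | y u = x u ∧ z u = x u} : ℤ) := by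
    rw [Finset.sum_congr rfl (fun u _ => h1 u), Finset.sum_comm]
    refine Finset.sum_congr rfl fun y _ => ?_
    rw [Finset.sum_comm]
    refine Finset.sum_congr rfl fun z _ => ?_
    rw [Finset.card_filter]
    push_cast
    rfl
  have hcard : 1 ≤ #X := Finset.card_pos.2 ⟨x, hx⟩
  have h3 : ∀ y ∈ X.erase x, (∑ z ∈ X, (#{u : U | y u = x u ∧ z u = x u} : ℤ)) =
      (#X : ℤ) * (Fintype.card K : ℤ) ^ 2 +
      ((Fintype.card K : ℤ) ^ 3 - (Fintype.card K : ℤ) ^ 2) * (lineCount K X x (y - x) : ℤ) := by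
    intro y hy
    have hyx := Finset.ne_of_mem_erase hy
    rw [← card_mem_line X hyx, Finset.card_filter]
    push_cast
    rw [Finset.mul_sum, ← nsmul_eq_mul, ← Finset.sum_const, ← Finset.sum_add_distrib]
    refine Finset.sum_congr rfl fun z _ => ?_
    rw [card_agree_pair hU hyx]
    split_ifs <;> push_cast <;> ring
  have h4 : (∑ z ∈ X, (#{u : U | x u = x u ∧ z u = x u} : ℤ)) =
      (Fintype.card K : ℤ) ^ 4 + (#X - 1) * (Fintype.card K : ℤ) ^ 3 := by
    have := sum_card_apply_eq hU X hx
    simp_rw [Finset.card_filter] at this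
    rw [Finset.sum_comm] at this
    simp_rw [← Finset.card_filter] at this
    have := congrArg (Nat.cast : ℕ → ℤ) this
    push_cast [Nat.cast_sub hcard] at this
    simpa using this
  rw [h2, ← Finset.add_sum_erase _ _ hx, Finset.sum_congr rfl h3, Finset.sum_add_distrib,
    Finset.sum_const, ← Finset.mul_sum, h4, Finset.card_erase_of_mem hx, nsmul_eq_mul,
    Nat.cast_sub hcard]
  push_cast
  ring

variable [Fintype (Dual K U)]

namespace IsTwoIntersectionSet

variable {X : Finset (Dual K U)} {φ : U → K}

/-- Over the lines through a point of `X`, the first two moments of the number of points of `X` are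
determined by the hyperplane sizes. They are those of a distribution on `{q/2, q}`; since all the
numbers lie between `q/2` and `q`, no other values occur. -/
theorem two_mul_lineCount_of_mem (h : IsTwoIntersectionSet X φ) {x : Dual K U} (hx : x ∈ X)
    {d : Dual K U} (hd : d ≠ 0) :
    2 * lineCount K X x d = Fintype.card K ∨ lineCount K X x d = Fintype.card K := by
  have hU := h.finrank_eq
  obtain ⟨q, hq⟩ : ∃ q : ℤ, q = (Fintype.card K : ℤ) := ⟨_, rfl⟩
  have hq2 : 1 < q := by rw [hq]; exact_mod_cast Fintype.one_lt_card (α := K)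
  have hcard : 1 ≤ #X := Finset.card_pos.2 ⟨x, hx⟩
  have hn : 2 * (#X : ℤ) = q ^ 4 + q ^ 2 := by rw [hq]; exact_mod_cast h.card_eq
  have hE : (#(univ.erase (0 : Dual K U)) : ℤ) = q ^ 4 - 1 := by
    rw [Finset.card_erase_of_mem (Finset.mem_univ _), Finset.card_univ, card_dual hU,
      Nat.cast_sub (Nat.one_le_pow _ _ Fintype.card_pos)]
    push_cast; rw [hq]
  have hUc : (#(univ.erase (0 : U)) : ℤ) = q ^ 4 - 1 := by
    rw [Finset.card_erase_of_mem (Finset.mem_univ _), Finset.card_univ, card_of_finrank_four hU,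
      Nat.cast_sub (Nat.one_le_pow _ _ Fintype.card_pos)]
    push_cast; rw [hq]
  have s1 := sum_lineCount_mul (K := K) X x (fun _ => 1) (by simp)
  have s2 := sum_lineCount_mul (K := K) X x (fun d => (lineCount K X x d : ℤ))
    (fun t ht d => by rw [lineCount_smul _ _ _ ht])
  simp only [hx, if_true, mul_one, Finset.sum_const, nsmul_eq_mul, hE,
    Finset.card_erase_of_mem hx, Nat.cast_sub hcard, ← hq, Nat.cast_one] at s1 s2
  have a1 := congrArg (Nat.cast : ℕ → ℤ) (sum_card_apply_eq hU X hx)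
  push_cast [Nat.cast_sub hcard] at a1
  have a2 := sum_card_apply_eq_sq hU X hx
  rw [← Finset.add_sum_erase _ _ (Finset.mem_univ (0 : U))] at a1 a2
  have a3 : ∀ u ∈ univ.erase (0 : U), 4 * (#{y ∈ X | y u = x u} : ℤ) ^ 2 =
      (2 * q ^ 3 + q ^ 2) * 2 * #{y ∈ X | y u = x u} - q ^ 3 * (q ^ 3 + q ^ 2) := by
    intro u hu
    have := congrArg (Nat.cast : ℕ → ℤ) (h.card_apply_eq u (Finset.ne_of_mem_erase hu) (x u))
    push_cast at this
    rw [← hq] at this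
    split_ifs at this
    · linear_combination (2 * (#{y ∈ X | y u = x u} : ℤ) - q ^ 3) * this
    · linear_combination (2 * (#{y ∈ X | y u = x u} : ℤ) - q ^ 3 - q ^ 2) * this
  have a4 := Finset.sum_congr rfl a3
  rw [← Finset.mul_sum, Finset.sum_sub_distrib, ← Finset.mul_sum, Finset.sum_const, nsmul_eq_mul,
    hUc] at a4
  simp only [LinearMap.map_zero, Finset.filter_true, ← hq] at a1 a2
  have key : ∑ d ∈ univ.erase (0 : Dual K U),
      (2 * (lineCount K X x d : ℤ) - q) * (q - lineCount K X x d) = 0 := by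
    have e : ∀ d : Dual K U, (2 * (lineCount K X x d : ℤ) - q) * (q - lineCount K X x d) =
        3 * q * lineCount K X x d - 2 * (lineCount K X x d * lineCount K X x d) - q ^ 2 := by
      intro d; ring
    rw [Finset.sum_congr rfl (fun d _ => e d), Finset.sum_sub_distrib, Finset.sum_sub_distrib,
      ← Finset.mul_sum, ← Finset.mul_sum, Finset.sum_const, nsmul_eq_mul, hE, s2, s1]
    have hq0 : q ^ 2 * 2 ≠ 0 := by positivity
    apply mul_left_cancel₀ hq0
    generalize (∑ u ∈ univ.erase (0 : U), (#{y ∈ X | y u = x u} : ℤ)) = A1 at *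
    generalize (∑ u ∈ univ.erase (0 : U), (#{y ∈ X | y u = x u} : ℤ) ^ 2) = A2 at *
    generalize (∑ y ∈ X.erase x, (lineCount K X x (y - x) : ℤ)) = M at *
    generalize (#X : ℤ) = n at *
    have hA1 : A1 = q ^ 4 + (n - 1) * q ^ 3 - n := by linear_combination a1
    have hM : (q ^ 3 - q ^ 2) * M =
      n ^ 2 + A2 - (q ^ 4 + (n - 1) * q ^ 3 + (n - 1) * n * q ^ 2) := by linear_combination -a2
    subst hA1
    linear_combination
      ((2 * q ^ 2 - 2) * n - q ^ 3 * (q ^ 3 + q ^ 2 - 3 * q + 1)) * hn - 4 * hM - a4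
  have hnn : ∀ d ∈ univ.erase (0 : Dual K U),
      0 ≤ (2 * (lineCount K X x d : ℤ) - q) * (q - lineCount K X x d) := by
    intro d hd
    have h1 : q ≤ 2 * (lineCount K X x d : ℤ) := by
      rw [hq]; exact_mod_cast h.le_lineCount x hx d (Finset.ne_of_mem_erase hd)
    have h2 : (lineCount K X x d : ℤ) ≤ q := by rw [hq]; exact_mod_cast lineCount_le X x d
    exact mul_nonneg (by linarith) (by linarith)
  have := (Finset.sum_eq_zero_iff_of_nonneg hnn).1 key d (by simp [hd])
  rcases mul_eq_zero.1 this with h0 | h0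
  · left; zify; linarith
  · right; zify; linarith

end IsTwoIntersectionSet
end AffineSet

end

/-! ### Pencils of hyperplanes and planes contained in the set -/

section

open Finset Module
open scoped Classical

section Pencil

/-- The function `φ` is linear on the span of `u` and `v`. -/
def IsLinearOn {K U : Type*} [Field K] [AddCommGroup U] [Module K U] (φ : U → K) (u v : U) : Prop :=
  ∀ a b : K, φ (a • u + b • v) = a * φ u + b * φ v

theorem IsLinearOn.symm {K U : Type*} [Field K] [AddCommGroup U] [Module K U] {φ : U → K} {u v : U}
    (h : IsLinearOn φ u v) : IsLinearOn φ v u := fun a b => by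
  rw [add_comm, h b a, add_comm]

variable {K U : Type*} [Field K] [Fintype K] [AddCommGroup U] [Module K U]

/-- The `q + 1` hyperplanes through a plane cover the points of the plane `q + 1` times and all
other points once. -/
theorem sum_pencil (X : Finset (Dual K U)) (u v : U) (a b : K) :
    ∑ t : K, #{y ∈ X | y (v + t • u) = b + t * a} + #{y ∈ X | y u = a} =
      #X + Fintype.card K * #{y ∈ X | y u = a ∧ y v = b} := by
  have hy : ∀ y : Dual K U, (∑ t : K, if y (v + t • u) = b + t * a then 1 else 0) +
      (if y u = a then 1 else 0) =
      1 + Fintype.card K * (if y u = a ∧ y v = b then 1 else 0) := by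
    intro y
    by_cases hu : y u = a
    · have h1 : ∀ t : K, y (v + t • u) = b + t * a ↔ y v = b := by
        intro t
        rw [map_add, map_smul, smul_eq_mul, hu, add_left_inj]
      simp only [h1, hu]
      by_cases hv : y v = b <;> simp [hv, add_comm]
    · have h1 : ∀ t : K, y (v + t • u) = b + t * a ↔ t = (b - y v) / (y u - a) := by
        intro t
        rw [eq_div_iff (sub_ne_zero.2 hu), map_add, map_smul, smul_eq_mul]
        constructor <;> intro h <;> linear_combination h
      simp only [h1, hu]
      simp
  simp_rw [Finset.card_filter]
  rw [Finset.sum_comm, ← Finset.sum_add_distrib, Finset.sum_congr rfl (fun y _ => hy y),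
    Finset.sum_add_distrib, ← Finset.mul_sum]
  simp

variable [Fintype (Dual K U)]

theorem card_plane_eq_iff (hU : finrank K U = 4) (X : Finset (Dual K U)) {u v : U}
    (huv : LinearIndependent K ![u, v]) (a b : K) :
    #{y ∈ X | y u = a ∧ y v = b} = Fintype.card K ^ 2 ↔
      ∀ y : Dual K U, y u = a → y v = b → y ∈ X := by
  rw [← card_dual_apply_eq_pair hU huv a b]
  constructor
  · intro h y h1 h2
    have h3 : ({y ∈ X | y u = a ∧ y v = b} : Finset (Dual K U)) =
        ({y | y u = a ∧ y v = b} : Finset (Dual K U)) :=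
      Finset.eq_of_subset_of_card_le (Finset.filter_subset_filter _ (Finset.subset_univ _)) h.ge
    have : y ∈ ({y | y u = a ∧ y v = b} : Finset (Dual K U)) := by simp [h1, h2]
    rw [← h3] at this
    exact (Finset.mem_filter.1 this).1
  · intro h
    congr 1
    ext y
    simp only [Finset.mem_filter, Finset.mem_univ, true_and]
    exact ⟨fun h => h.2, fun h' => ⟨h y h'.1 h'.2, h'⟩⟩

end Pencil

namespace IsTwoIntersectionSet

variable {K U : Type*} [Field K] [Fintype K] [AddCommGroup U] [Module K U]
  {X : Finset (Dual K U)} {φ : U → K}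

theorem card_apply_eq_iff (h : IsTwoIntersectionSet X φ) {u : U} (hu : u ≠ 0) (c : K) :
    2 * #{x ∈ X | x u = c} = Fintype.card K ^ 3 + Fintype.card K ^ 2 ↔ c = φ u := by
  rw [h.card_apply_eq u hu c]
  have := Fintype.card_pos (α := K)
  constructor
  · intro h'
    by_contra hc
    rw [if_neg hc] at h'
    have : 0 < Fintype.card K ^ 2 := by positivity
    omega
  · intro h'
    rw [if_pos h']

theorem card_apply_le (h : IsTwoIntersectionSet X φ) {u : U} (hu : u ≠ 0) (c : K) :
    2 * #{x ∈ X | x u = c} ≤ Fintype.card K ^ 3 + Fintype.card K ^ 2 := by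
  rw [h.card_apply_eq u hu c]
  split_ifs <;> omega

theorem map_smul (h : IsTwoIntersectionSet X φ) (c : K) (u : U) : φ (c • u) = c * φ u := by
  by_cases hc : c = 0
  · simp [hc, h.map_zero]
  by_cases hu : u = 0
  · simp [hu, h.map_zero]
  symm
  rw [← h.card_apply_eq_iff (smul_ne_zero hc hu), ← (h.card_apply_eq_iff hu (φ u)).2 rfl]
  simp [hc]

theorem isLinearOn_smul_right (h : IsTwoIntersectionSet X φ) (c : K) (u : U) :
    IsLinearOn φ u (c • u) := by
  intro a b
  rw [smul_smul, ← add_smul, h.map_smul, h.map_smul]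
  ring

variable [Fintype (Dual K U)]

/-- A plane inside `X` lies on large hyperplanes only, since their sizes add up to the greatest
value possible. -/
theorem isLinearOn_of_plane_subset (h : IsTwoIntersectionSet X φ) {u v : U}
    (huv : LinearIndependent K ![u, v]) {a b : K}
    (hX : ∀ y : Dual K U, y u = a → y v = b → y ∈ X) :
    a = φ u ∧ b = φ v ∧ IsLinearOn φ u v := by
  have hu : u ≠ 0 := huv.ne_zero 0
  have hvu : ∀ t : K, v + t • u ≠ 0 := by
    intro t ht
    have := (LinearIndependent.pair_iff.1 huv t 1 (by rw [one_smul, add_comm, ht])).2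
    exact one_ne_zero this
  have hs := sum_pencil X u v a b
  rw [(card_plane_eq_iff h.finrank_eq X huv a b).2 hX] at hs
  have hn := h.card_eq
  have h1 : ∀ t ∈ (univ : Finset K), 2 * #{y ∈ X | y (v + t • u) = b + t * a} ≤
      Fintype.card K ^ 3 + Fintype.card K ^ 2 := fun t _ => h.card_apply_le (hvu t) _
  have h2 := h.card_apply_le hu a
  have h3 := Finset.sum_le_sum h1
  rw [Finset.sum_const, Finset.card_univ, ← Finset.mul_sum, smul_eq_mul] at h3
  have ha : 2 * #{y ∈ X | y u = a} = Fintype.card K ^ 3 + Fintype.card K ^ 2 := by nlinarith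
  have hb : ∑ t : K, 2 * #{y ∈ X | y (v + t • u) = b + t * a} =
      ∑ t : K, (Fintype.card K ^ 3 + Fintype.card K ^ 2) := by
    rw [← Finset.mul_sum, Finset.sum_const, Finset.card_univ, smul_eq_mul]
    nlinarith
  have ha' := (h.card_apply_eq_iff hu a).1 ha
  have hb' : ∀ t : K, b + t * a = φ (v + t • u) := fun t =>
    (h.card_apply_eq_iff (hvu t) _).1 ((Finset.sum_eq_sum_iff_of_le h1).1 hb t (Finset.mem_univ t))
  have hb0 : b = φ v := by simpa using hb' 0
  refine ⟨ha', hb0, fun c e => ?_⟩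
  by_cases he : e = 0
  · simp [he, h.map_smul]
  · have : c • u + e • v = e • (v + (c / e) • u) := by
      rw [smul_add, smul_smul, mul_div_cancel₀ _ he, add_comm]
    rw [this, h.map_smul, ← hb', ← ha', ← hb0]
    field_simp
    ring

theorem plane_subset_of_isLinearOn (h : IsTwoIntersectionSet X φ) {u v : U}
    (huv : LinearIndependent K ![u, v]) (hl : IsLinearOn φ u v) {y : Dual K U} (hyu : y u = φ u)
    (hyv : y v = φ v) : y ∈ X := by
  refine (card_plane_eq_iff h.finrank_eq X huv (φ u) (φ v)).1 ?_ y hyu hyv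
  have hu : u ≠ 0 := huv.ne_zero 0
  have hvu : ∀ t : K, v + t • u ≠ 0 := by
    intro t ht
    have := (LinearIndependent.pair_iff.1 huv t 1 (by rw [one_smul, add_comm, ht])).2
    exact one_ne_zero this
  have hs := sum_pencil X u v (φ u) (φ v)
  have h1 : ∀ t ∈ (univ : Finset K), 2 * #{y ∈ X | y (v + t • u) = φ v + t * φ u} =
      Fintype.card K ^ 3 + Fintype.card K ^ 2 := by
    intro t _
    rw [h.card_apply_eq_iff (hvu t)]
    simpa [add_comm] using (hl t 1).symm
  have h2 := (h.card_apply_eq_iff hu (φ u)).2 rfl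
  have h3 := Finset.sum_congr rfl h1
  rw [Finset.sum_const, Finset.card_univ, ← Finset.mul_sum, smul_eq_mul] at h3
  have hn := h.card_eq
  refine Nat.eq_of_mul_eq_mul_left (Nat.mul_pos two_pos (Fintype.card_pos (α := K))) ?_
  nlinarith

variable [Fintype U]

theorem lineCount_cases (h : IsTwoIntersectionSet X φ) (x : Dual K U) {d : Dual K U} (hd : d ≠ 0) :
    lineCount K X x d = 0 ∨ 2 * lineCount K X x d = Fintype.card K ∨
      lineCount K X x d = Fintype.card K := by
  by_cases h0 : lineCount K X x d = 0
  · exact Or.inl h0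
  · right
    rw [lineCount_eq_zero_iff] at h0
    push Not at h0
    obtain ⟨t, ht⟩ := h0
    rw [← lineCount_add_smul X x d t]
    exact h.two_mul_lineCount_of_mem ht hd

theorem two_mul_lineCount_of_not_mem (h : IsTwoIntersectionSet X φ) {x d : Dual K U} (hx : x ∉ X)
    (hd : d ≠ 0) : lineCount K X x d = 0 ∨ 2 * lineCount K X x d = Fintype.card K := by
  rcases h.lineCount_cases x hd with h0 | h0 | h0
  · exact Or.inl h0
  · exact Or.inr h0
  · rw [lineCount_eq_card_iff] at h0
    exact absurd (by simpa using h0 0) hx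

end IsTwoIntersectionSet

end

/-! ### Large hyperplanes meet the set in cylinders -/

section

open Finset Module
open scoped Classical

section

theorem sum_lineCount_filter {K E : Type*} [Field K] [Fintype K] [AddCommGroup E] [Module K E]
    [Fintype E] [DecidableEq E] (X : Finset E) (x : E) (p : E → Prop) [DecidablePred p]
    (hp : ∀ t : K, t ≠ 0 → ∀ d, p (t • d) ↔ p d) :
    ∑ d with d ≠ 0 ∧ p d, (lineCount K X x d : ℤ) =
      (if x ∈ X then (#{d : E | d ≠ 0 ∧ p d} : ℤ) else 0) +
        ((Fintype.card K : ℤ) - 1) * #{y ∈ X | y ≠ x ∧ p (y - x)} := by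
  have h := sum_lineCount_mul (K := K) X x (fun d => if p d then 1 else 0)
    (fun t ht d => by simp [hp t ht d])
  simp only [mul_ite, mul_one, mul_zero, Finset.sum_boole] at h
  rw [← Finset.sum_filter] at h
  have e1 : (univ.erase (0 : E)).filter p = ({d : E | d ≠ 0 ∧ p d} : Finset E) := by
    ext d; simp
  have e2 : (X.erase x).filter (fun y => p (y - x)) =
      ({y ∈ X | y ≠ x ∧ p (y - x)} : Finset E) := by
    ext y; simp only [Finset.mem_filter, Finset.mem_erase]; tauto
  rw [e1, e2] at h
  exact h

theorem card_ne_zero_and {E : Type*} [Fintype E] [Zero E] [DecidableEq E] (p : E → Prop)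
    [DecidablePred p] (h0 : p 0) :
    (#{d : E | d ≠ 0 ∧ p d} : ℤ) = #{d : E | p d} - 1 := by
  have : ({d : E | d ≠ 0 ∧ p d} : Finset E) = ({d : E | p d} : Finset E).erase 0 := by
    ext d; simp
  rw [this, Finset.card_erase_of_mem (by simpa using h0), Nat.cast_sub]
  · rfl
  · exact Finset.card_pos.2 ⟨0, by simpa using h0⟩

end

namespace IsTwoIntersectionSet

variable {K U : Type*} [Field K] [Fintype K] [AddCommGroup U] [Module K U]
  [Fintype (Dual K U)] [Fintype U] {X : Finset (Dual K U)} {φ : U → K}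

/-- Inside a large hyperplane, a point outside `X` lies on exactly one line missing `X`: that line
has `q - 1` direction vectors. -/
theorem card_missing_directions (h : IsTwoIntersectionSet X φ) {u : U} (hu : u ≠ 0)
    {z : Dual K U} (hz : z ∉ X) (hzu : z u = φ u) :
    #{d : Dual K U | (d ≠ 0 ∧ d u = 0) ∧ lineCount K X z d = 0} = Fintype.card K - 1 := by
  have h1 := sum_lineCount_filter X z (fun d => d u = 0) (K := K) (fun t ht d => by simp [ht])
  have h2 : ({y ∈ X | y ≠ z ∧ (y - z) u = 0} : Finset (Dual K U)) =
      {y ∈ X | y u = φ u} := by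
    ext y
    simp only [Finset.mem_filter, LinearMap.sub_apply, sub_eq_zero, hzu]
    constructor
    · tauto
    · rintro ⟨hy, hyu⟩
      exact ⟨hy, fun hyz => hz (hyz ▸ hy), hyu⟩
  have h3 := congrArg (Nat.cast : ℕ → ℤ) ((h.card_apply_eq_iff hu (φ u)).2 rfl)
  have h4 : ∀ d ∈ ({d : Dual K U | d ≠ 0 ∧ d u = 0} : Finset (Dual K U)),
      2 * (lineCount K X z d : ℤ) =
        Fintype.card K - Fintype.card K * if lineCount K X z d = 0 then 1 else 0 := by
    intro d hd
    rcases h.two_mul_lineCount_of_not_mem hz (Finset.mem_filter.1 hd).2.1 with h0 | h0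
    · simp [h0]
    · have : lineCount K X z d ≠ 0 := by
        have := Fintype.card_pos (α := K)
        omega
      simp only [this, if_false, mul_zero, sub_zero]
      exact_mod_cast h0
  have h5 := Finset.sum_congr rfl h4
  rw [← Finset.mul_sum, h1, h2, if_neg hz, Finset.sum_sub_distrib, Finset.sum_const, nsmul_eq_mul,
    ← Finset.mul_sum, Finset.sum_boole, Finset.filter_filter,
    card_ne_zero_and _ (by simp), card_dual_apply_eq h.finrank_eq hu] at h5
  push_cast at h3 h5
  have hq := Fintype.card_pos (α := K)
  rw [← Nat.cast_inj (R := ℤ), Nat.cast_sub hq]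
  push_cast
  have hq0 : (Fintype.card K : ℤ) ≠ 0 := by exact_mod_cast hq.ne'
  apply mul_left_cancel₀ hq0
  linear_combination (1 - (Fintype.card K : ℤ)) * h3 + h5

theorem missing_direction_unique (h : IsTwoIntersectionSet X φ) {u : U} (hu : u ≠ 0)
    {z : Dual K U} (hz : z ∉ X) (hzu : z u = φ u) {d d' : Dual K U} (hd : d ≠ 0) (hdu : d u = 0)
    (hdz : lineCount K X z d = 0) (hd' : d' ≠ 0) (hdu' : d' u = 0)
    (hdz' : lineCount K X z d' = 0) : ∃ t : K, t • d = d' := by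
  have hcard := h.card_missing_directions hu hz hzu
  have hsub : (univ.erase (0 : K)).image (fun t => t • d) ⊆
      ({d : Dual K U | (d ≠ 0 ∧ d u = 0) ∧ lineCount K X z d = 0} : Finset (Dual K U)) := by
    intro y hy
    obtain ⟨t, ht, rfl⟩ := Finset.mem_image.1 hy
    have ht0 := Finset.ne_of_mem_erase ht
    simp [ht0, hd, hdu, lineCount_smul X z d ht0, hdz]
  have heq := Finset.eq_of_subset_of_card_le hsub (by
    rw [hcard, Finset.card_image_of_injective _ (smul_left_injective K hd),
      Finset.card_erase_of_mem (Finset.mem_univ _), Finset.card_univ])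
  have hmem : d' ∈ ({d : Dual K U | (d ≠ 0 ∧ d u = 0) ∧ lineCount K X z d = 0} :
      Finset (Dual K U)) := by simp [hd', hdu', hdz']
  rw [← heq] at hmem
  obtain ⟨t, _, ht⟩ := Finset.mem_image.1 hmem
  exact ⟨t, ht⟩

theorem exists_missing_direction (h : IsTwoIntersectionSet X φ) {u : U} (hu : u ≠ 0)
    {z : Dual K U} (hz : z ∉ X) (hzu : z u = φ u) :
    ∃ d : Dual K U, d ≠ 0 ∧ d u = 0 ∧ lineCount K X z d = 0 := by
  have hcard := h.card_missing_directions hu hz hzu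
  have hq := Fintype.one_lt_card (α := K)
  have hpos : 0 < Fintype.card K - 1 := by omega
  rw [← hcard, Finset.card_pos] at hpos
  obtain ⟨d, hd⟩ := hpos
  obtain ⟨⟨h1, h2⟩, h3⟩ := (Finset.mem_filter.1 hd).2
  exact ⟨d, h1, h2, h3⟩

end IsTwoIntersectionSet

/-- The points of a plane through `z ∉ X`, counted along the lines of the plane through `z`. -/
theorem card_plane_eq_sum_lineCount {K E : Type*} [Field K] [Fintype K] [AddCommGroup E]
    [Module K E] (X : Finset E) {z : E} (hz : z ∉ X) (d e : E) :
    #{p : K × K | z + p.1 • d + p.2 • e ∈ X} =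
      lineCount K X z d + ∑ s : K, lineCount K X z (e + s • d) := by
  have h1 : ∀ s : K, lineCount K X z (e + s • d) =
      ∑ t ∈ univ.erase (0 : K), if z + t • (e + s • d) ∈ X then 1 else 0 := by
    intro s
    rw [lineCount, Finset.card_filter, ← Finset.add_sum_erase _ _ (Finset.mem_univ (0 : K))]
    simp [hz]
  have h2 : ∀ t ∈ univ.erase (0 : K), (∑ s : K, if z + t • (e + s • d) ∈ X then 1 else 0) =
      ∑ s : K, if z + s • d + t • e ∈ X then 1 else 0 := by
    intro t ht
    refine Fintype.sum_equiv (Equiv.mulLeft₀ t (Finset.ne_of_mem_erase ht)) _ _ fun s => ?_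
    have : z + (t * s) • d + t • e = z + t • (e + s • d) := by
      rw [smul_add, mul_smul]; abel
    simp [this]
  rw [Finset.card_filter, Fintype.sum_prod_type_right,
    ← Finset.add_sum_erase _ _ (Finset.mem_univ (0 : K)), Finset.sum_congr rfl (fun s _ => h1 s),
    Finset.sum_comm (s := univ), Finset.sum_congr rfl h2]
  simp [lineCount]

theorem card_plane_swap {K E : Type*} [Field K] [Fintype K] [AddCommGroup E] [Module K E]
    (X : Finset E) (z z' d : E) :
    #{p : K × K | z' + p.1 • d + p.2 • (z - z') ∈ X} =
      #{p : K × K | z + p.1 • d + p.2 • (z' - z) ∈ X} := by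
  refine Finset.card_equiv ((Equiv.refl K).prodCongr (Equiv.subLeft 1)) fun p => ?_
  have : z + p.1 • d + (1 - p.2) • (z' - z) = z' + p.1 • d + p.2 • (z - z') := by module
  simp [this]

/-- If, in the affine subspace through `z` with direction `L`, each point outside `X` is on at most
one line missing `X`, then those lines are all parallel. Otherwise, in the plane spanned by
a missing line through `z` and a point `z'`, counting the points of `X` from `z` and from `z'`
shows that `z'` is also on a missing line of that plane. The two lines meet in a point that is on
two missing lines. -/
theorem lineCount_eq_zero_of_parallel {K E : Type*} [Field K] [Fintype K] [AddCommGroup E]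
    [Module K E] (X : Finset E) (L : Submodule K E) {z z' d : E}
    (hX : ∀ x ∉ X, ∀ e ≠ 0, lineCount K X x e = 0 ∨ 2 * lineCount K X x e = Fintype.card K)
    (huniq : ∀ w ∉ X, w - z ∈ L → ∀ e ∈ L, e ≠ 0 → lineCount K X w d = 0 →
      lineCount K X w e = 0 → ∃ t : K, t • d = e)
    (hz : z ∉ X) (hz' : z' ∉ X) (hzz' : z' - z ∈ L) (hd : d ≠ 0) (hdL : d ∈ L)
    (hdz : lineCount K X z d = 0) : lineCount K X z' d = 0 := by
  by_contra hne
  have hd2 : 2 * lineCount K X z' d = Fintype.card K := (hX z' hz' d hd).resolve_left hne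
  have hpar : ∀ s t : K, t • d ≠ (z' - z) + s • d := by
    intro s t ht
    have ht' : (t - s) • d = z' - z := by rw [sub_smul, ht, add_sub_cancel_right]
    apply hne
    rw [← hdz, ← lineCount_add_smul X z d (t - s), ht', add_sub_cancel]
  have hpar0 : ∀ s : K, (z' - z) + s • d ≠ 0 := fun s hs => hpar s 0 (by rw [hs, zero_smul])
  have hL : ∀ s : K, (z' - z) + s • d ∈ L := fun s => L.add_mem hzz' (L.smul_mem s hdL)
  have c1 : ∀ s : K, 2 * lineCount K X z ((z' - z) + s • d) = Fintype.card K := by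
    intro s
    refine (hX z hz _ (hpar0 s)).resolve_left fun h0 => ?_
    obtain ⟨t, ht⟩ := huniq z hz (by simp) _ (hL s) (hpar0 s) hdz h0
    exact hpar s t ht
  have c2 : ∀ s : K, 2 * lineCount K X z' ((z - z') + s • d) = Fintype.card K := by
    intro s
    have e : (z - z') + s • d = (-1 : K) • ((z' - z) + (-s) • d) := by module
    rw [e, lineCount_smul _ _ _ (by simp)]
    refine (hX z' hz' _ (hpar0 _)).resolve_left fun h0 => ?_
    -- the point where the line through `z'` meets the missing line through `z`
    have hwz : z + s • d = z' + (-1 : K) • ((z' - z) + (-s) • d) := by module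
    obtain ⟨t, ht⟩ := huniq (z + s • d) ((lineCount_eq_zero_iff X z d).1 hdz s)
      (by simpa using L.smul_mem s hdL) _ (hL (-s)) (hpar0 (-s))
      (by rw [lineCount_add_smul, hdz]) (by rw [hwz, lineCount_add_smul, h0])
    exact hpar _ t ht
  have p1 := card_plane_eq_sum_lineCount (K := K) X hz d (z' - z)
  have p2 := card_plane_eq_sum_lineCount (K := K) X hz' d (z - z')
  have p3 := card_plane_swap (K := K) X z z' d
  have s1 := Finset.sum_congr (rfl : (univ : Finset K) = univ) (fun s _ => c1 s)
  have s2 := Finset.sum_congr (rfl : (univ : Finset K) = univ) (fun s _ => c2 s)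
  rw [← Finset.mul_sum] at s1 s2
  have := Fintype.card_pos (α := K)
  omega

namespace IsTwoIntersectionSet

variable {K U : Type*} [Field K] [Fintype K] [AddCommGroup U] [Module K U]
  [Fintype (Dual K U)] [Fintype U] {X : Finset (Dual K U)} {φ : U → K}

theorem missing_direction_parallel (h : IsTwoIntersectionSet X φ) {u : U} (hu : u ≠ 0)
    {z z' : Dual K U} (hz : z ∉ X) (hzu : z u = φ u) (hz' : z' ∉ X) (hzu' : z' u = φ u)
    {d : Dual K U} (hd : d ≠ 0) (hdu : d u = 0) (hdz : lineCount K X z d = 0) :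
    lineCount K X z' d = 0 := by
  refine lineCount_eq_zero_of_parallel X (LinearMap.ker (Dual.eval K U u))
    (fun x hx e he => h.two_mul_lineCount_of_not_mem hx he) ?_ hz hz' (by simp [hzu, hzu']) hd
    (by simpa using hdu) hdz
  intro w hw hwz e he he0 h1 h2
  have hwu : w u = φ u := by
    rw [LinearMap.mem_ker, Dual.eval_apply, LinearMap.sub_apply, sub_eq_zero, hzu] at hwz
    exact hwz
  exact h.missing_direction_unique hu hw hwu hd hdu h1 he0 (by simpa using he) h2

/-- A large hyperplane meets `X` in a cylinder. -/
theorem exists_cylinder_direction (h : IsTwoIntersectionSet X φ) {u : U} (hu : u ≠ 0) :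
    ∃ d : Dual K U, d ≠ 0 ∧ d u = 0 ∧ (∃ z, z ∉ X ∧ z u = φ u) ∧
      ∀ z, z u = φ u → z ∉ X → ∀ t : K, z + t • d ∉ X := by
  have hz : ∃ z, z ∉ X ∧ z u = φ u := by
    by_contra! hcon
    have h1 := (h.card_apply_eq_iff hu (φ u)).2 rfl
    have h2 : X.filter (fun x => x u = φ u) = univ.filter (fun x : Dual K U => x u = φ u) := by
      ext x
      simp only [Finset.mem_filter, Finset.mem_univ, true_and, and_iff_right_iff_imp]
      intro hx
      by_contra hxX
      exact hcon x hxX hx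
    rw [h2, card_dual_apply_eq h.finrank_eq hu] at h1
    have := Fintype.one_lt_card (α := K)
    have : Fintype.card K ^ 2 * 1 < Fintype.card K ^ 2 * Fintype.card K := by gcongr
    nlinarith
  obtain ⟨z, hz, hzu⟩ := hz
  obtain ⟨d, hd, hdu, hdz⟩ := h.exists_missing_direction hu hz hzu
  refine ⟨d, hd, hdu, ⟨z, hz, hzu⟩, fun z' hzu' hz' => ?_⟩
  exact (lineCount_eq_zero_iff X z' d).1
    (h.missing_direction_parallel hu hz hzu hz' hzu' hd hdu hdz)

end IsTwoIntersectionSet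

end

/-! ### The lines on which `φ` is linear -/

section

open Finset Module
open scoped Classical

namespace IsTwoIntersectionSet

variable {K U : Type*} [Field K] [Fintype K] [AddCommGroup U] [Module K U]
  [Fintype (Dual K U)] [Fintype U] {X : Finset (Dual K U)} {φ : U → K}

theorem two_mul_card_plane_lt (h : IsTwoIntersectionSet X φ) {u v : U}
    (huv : LinearIndependent K ![u, v]) {z d : Dual K U} (hz : z ∉ X) (hd : d ≠ 0) (hdu : d u = 0)
    (hdv : d v = 0) (hdz : lineCount K X z d = 0) :
    2 * #{y ∈ X | y u = z u ∧ y v = z v} < Fintype.card K ^ 2 + Fintype.card K := by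
  have h1 := sum_lineCount_filter X z (fun d => d u = 0 ∧ d v = 0) (K := K)
    (fun t ht d => by simp [ht])
  have h2 : X.filter (fun y => y ≠ z ∧ (y - z) u = 0 ∧ (y - z) v = 0) =
      X.filter (fun y => y u = z u ∧ y v = z v) := by
    ext y
    simp only [Finset.mem_filter, LinearMap.sub_apply, sub_eq_zero]
    constructor
    · tauto
    · rintro ⟨hy, hyu⟩
      exact ⟨hy, fun hyz => hz (hyz ▸ hy), hyu⟩
  have hq := Fintype.one_lt_card (α := K)
  have h3 : ∑ e with e ≠ 0 ∧ e u = 0 ∧ e v = 0, 2 * (lineCount K X z e : ℤ) <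
      ∑ e : Dual K U with e ≠ 0 ∧ e u = 0 ∧ e v = 0, (Fintype.card K : ℤ) := by
    refine Finset.sum_lt_sum ?_ ⟨d, by simp [hd, hdu, hdv], by rw [hdz]; push_cast; omega⟩
    intro e he
    rcases h.two_mul_lineCount_of_not_mem hz (Finset.mem_filter.1 he).2.1 with h0 | h0
    · simp [h0]
    · exact_mod_cast h0.le
  rw [← Finset.mul_sum, h1, h2, if_neg hz, Finset.sum_const, nsmul_eq_mul,
    card_ne_zero_and _ (by simp), card_dual_apply_eq_pair h.finrank_eq huv] at h3
  zify at hq ⊢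
  push_cast at h3
  nlinarith

/-- The lines on which `φ` is linear and that pass through a given point form a pencil in a plane
(of the projective space of `U`): the annihilator of the direction of a cylinder. -/
theorem isLinearOn_iff (h : IsTwoIntersectionSet X φ) {u : U} (hu : u ≠ 0) {d : Dual K U}
    (hd : d ≠ 0) (hdu : d u = 0) (hz : ∃ z, z ∉ X ∧ z u = φ u)
    (hcyl : ∀ z, z u = φ u → z ∉ X → ∀ t : K, z + t • d ∉ X) (v : U) :
    IsLinearOn φ u v ↔ d v = 0 := by
  by_cases huv : LinearIndependent K ![u, v]
  swap
  · rw [LinearIndependent.pair_iff' hu] at huv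
    push Not at huv
    obtain ⟨c, rfl⟩ := huv
    simp [hdu, h.isLinearOn_smul_right]
  constructor
  · intro hl
    by_contra hdv
    obtain ⟨z, hzX, hzu⟩ := hz
    refine hcyl z hzu hzX ((φ v - z v) / d v) (h.plane_subset_of_isLinearOn huv hl ?_ ?_)
    · simp [hzu, hdu]
    · simp [hdv]
  · intro hdv
    by_contra hl
    have h1 : ∀ c ∈ (univ : Finset K), 2 * #{y ∈ X | y u = φ u ∧ y v = c} <
        Fintype.card K ^ 2 + Fintype.card K := by
      intro c _
      have : ∃ z : Dual K U, z u = φ u ∧ z v = c ∧ z ∉ X := by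
        by_contra! hcon
        exact hl (h.isLinearOn_of_plane_subset huv hcon).2.2
      obtain ⟨z, hzu, rfl, hzX⟩ := this
      rw [← hzu]
      exact h.two_mul_card_plane_lt huv hzX hd hdu hdv
        ((lineCount_eq_zero_iff X z d).2 (hcyl z hzu hzX))
    have h2 := Finset.sum_lt_sum_of_nonempty Finset.univ_nonempty h1
    have h3 := (h.card_apply_eq_iff hu (φ u)).2 rfl
    have h4 := Finset.card_eq_sum_card_fiberwise (f := fun y : Dual K U => y v)
      (s := {y ∈ X | y u = φ u}) (t := univ) (by simp)
    simp_rw [Finset.filter_filter] at h4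
    rw [← Finset.mul_sum, ← h4, h3, Finset.sum_const, Finset.card_univ, smul_eq_mul] at h2
    exact absurd h2 (by ring_nf; exact lt_irrefl _)

theorem exists_dual_isLinearOn_iff (h : IsTwoIntersectionSet X φ) {u : U} (hu : u ≠ 0) :
    ∃ d : Dual K U, d ≠ 0 ∧ ∀ v, IsLinearOn φ u v ↔ d v = 0 := by
  obtain ⟨d, hd, hdu, hz, hcyl⟩ := h.exists_cylinder_direction hu
  exact ⟨d, hd, h.isLinearOn_iff hu hd hdu hz hcyl⟩

theorem exists_ne_zero_apply_eq (h : IsTwoIntersectionSet X φ) (x : Dual K U) :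
    ∃ u ≠ 0, x u = φ u := by
  have : Nontrivial U := Module.nontrivial_of_finrank_pos (R := K) (by rw [h.finrank_eq]; simp)
  obtain ⟨u, hu⟩ := exists_ne (0 : U)
  obtain ⟨d, hd, hdl⟩ := h.exists_dual_isLinearOn_iff hu
  have hv : ∃ v, d v = 0 ∧ ∀ t : K, t • u ≠ v := by
    by_contra! hcon
    have h1 : (univ.filter fun v => d v = 0) ⊆ univ.image (fun t : K => t • u) := by
      intro v hv
      obtain ⟨t, ht⟩ := hcon v (Finset.mem_filter.1 hv).2
      exact Finset.mem_image.2 ⟨t, Finset.mem_univ _, ht⟩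
    have h2 := (Finset.card_le_card h1).trans Finset.card_image_le
    rw [card_ker_dual h.finrank_eq hd, Finset.card_univ] at h2
    have hq := Fintype.one_lt_card (α := K)
    have : Fintype.card K * 1 < Fintype.card K * (Fintype.card K * Fintype.card K) := by
      gcongr
      nlinarith
    nlinarith
  obtain ⟨v, hdv, hv⟩ := hv
  have hl := (hdl v).2 hdv
  by_cases hu0 : x u - φ u = 0
  · exact ⟨u, hu, sub_eq_zero.1 hu0⟩
  · refine ⟨(-((x v - φ v) / (x u - φ u))) • u + (1 : K) • v, ?_, ?_⟩
    · intro h0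
      refine hv ((x v - φ v) / (x u - φ u)) ?_
      rw [one_smul, neg_smul, neg_add_eq_zero] at h0
      exact h0
    · rw [hl, map_add, _root_.map_smul, _root_.map_smul, smul_eq_mul, smul_eq_mul]
      field_simp
      ring

/-- In a large hyperplane, `x ∈ X` is on so many lines inside `X` that one of them does not have
the direction `d` of the cylinder. -/
theorem exists_full_direction (h : IsTwoIntersectionSet X φ) {x : Dual K U} (hx : x ∈ X) {u : U}
    (hu : u ≠ 0) (hxu : x u = φ u) (d : Dual K U) :
    ∃ e : Dual K U, e u = 0 ∧ (∀ t : K, t • d ≠ e) ∧ ∀ t : K, x + t • e ∈ X := by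
  by_contra! hcon
  have h1 := sum_lineCount_filter X x (fun d => d u = 0) (K := K) (fun t ht d => by simp [ht])
  have h2 : X.filter (fun y => y ≠ x ∧ (y - x) u = 0) =
      (X.filter (fun y => y u = φ u)).erase x := by
    ext y
    simp only [Finset.mem_filter, Finset.mem_erase, LinearMap.sub_apply, sub_eq_zero, hxu]
    tauto
  have h3 := congrArg (Nat.cast : ℕ → ℤ) ((h.card_apply_eq_iff hu (φ u)).2 rfl)
  have h4 : ∀ e ∈ (univ.filter fun e : Dual K U => e ≠ 0 ∧ e u = 0),
      2 * (lineCount K X x e : ℤ) ≤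
        Fintype.card K + Fintype.card K * if (∃ t : K, t • d = e) then 1 else 0 := by
    intro e he
    obtain ⟨he0, heu⟩ := (Finset.mem_filter.1 he).2
    split_ifs with hed
    · have := lineCount_le (K := K) X x e
      omega
    · rcases h.two_mul_lineCount_of_mem hx he0 with h0 | h0
      · simpa using (by exact_mod_cast h0.le : 2 * (lineCount K X x e : ℤ) ≤ Fintype.card K)
      · push Not at hed
        obtain ⟨t, ht⟩ := hcon e heu hed
        exact absurd ((lineCount_eq_card_iff X x e).1 h0 t) ht
  have h5 := Finset.sum_le_sum h4
  have h6 : #{a ∈ (univ.filter fun e : Dual K U => e ≠ 0 ∧ e u = 0) | ∃ t : K, t • d = a} ≤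
      Fintype.card K := by
    rw [← Finset.card_univ]
    refine le_trans (Finset.card_le_card ?_) (Finset.card_image_le (f := fun t : K => t • d))
    intro e he
    obtain ⟨t, ht⟩ := (Finset.mem_filter.1 he).2
    exact Finset.mem_image.2 ⟨t, Finset.mem_univ _, ht⟩
  have hxm : x ∈ X.filter (fun y => y u = φ u) := by simp [hx, hxu]
  rw [← Finset.mul_sum, h1, h2, if_pos hx, Finset.sum_add_distrib, Finset.sum_const, nsmul_eq_mul,
    ← Finset.mul_sum, Finset.sum_boole,
    card_ne_zero_and _ (by simp), card_dual_apply_eq h.finrank_eq hu,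
    Finset.card_erase_of_mem hxm, Nat.cast_sub (Finset.card_pos.2 ⟨x, hxm⟩)] at h5
  have hq := Fintype.one_lt_card (α := K)
  zify at hq h6
  push_cast at h3 h5
  generalize (Fintype.card K : ℤ) = q at *
  generalize (#(X.filter (fun y => y u = φ u)) : ℤ) = s at *
  have h7 : 2 * (q ^ 3 - 1 + (q - 1) * (s - 1)) ≤ (q ^ 3 - 1) * q + q * q := by
    nlinarith
  nlinarith [mul_pos (show (0 : ℤ) < q by linarith) (show (0 : ℤ) < q - 1 by linarith)]

/-- Every point of `X` lies on a plane contained in `X`. -/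
theorem exists_isLinearOn_of_mem (h : IsTwoIntersectionSet X φ) {x : Dual K U} (hx : x ∈ X) :
    ∃ u v : U, LinearIndependent K ![u, v] ∧ IsLinearOn φ u v ∧ x u = φ u ∧ x v = φ v := by
  obtain ⟨u, hu, hxu⟩ := h.exists_ne_zero_apply_eq x
  obtain ⟨d, hd, hdu, hz, hcyl⟩ := h.exists_cylinder_direction hu
  obtain ⟨e, heu, hde, hex⟩ := h.exists_full_direction hx hu hxu d
  have hli : LinearIndependent K ![d, e] := (LinearIndependent.pair_iff' hd).2 hde
  have hv : ∃ v, (d v = 0 ∧ e v = 0) ∧ ∀ t : K, t • u ≠ v := by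
    by_contra! hcon
    have h1 : (univ.filter fun v => d v = 0 ∧ e v = 0) ⊆ univ.image (fun t : K => t • u) := by
      intro v hv
      obtain ⟨t, ht⟩ := hcon v (Finset.mem_filter.1 hv).2
      exact Finset.mem_image.2 ⟨t, Finset.mem_univ _, ht⟩
    have h2 := (Finset.card_le_card h1).trans Finset.card_image_le
    rw [card_ker_dual_pair h.finrank_eq hli, Finset.card_univ] at h2
    have hq := Fintype.one_lt_card (α := K)
    nlinarith
  obtain ⟨v, ⟨hdv, hev⟩, hv⟩ := hv
  have huv : LinearIndependent K ![u, v] := (LinearIndependent.pair_iff' hu).2 hv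
  -- the plane through `x` with directions `d` and `e` is `{y | y u = x u ∧ y v = x v}`
  have hspan : (univ : Finset (K × K)).image (fun p => p.1 • d + p.2 • e) =
      univ.filter fun y : Dual K U => y u = 0 ∧ y v = 0 := by
    refine Finset.eq_of_subset_of_card_le ?_ ?_
    · intro y hy
      obtain ⟨p, _, rfl⟩ := Finset.mem_image.1 hy
      simp [hdu, heu, hdv, hev]
    · rw [card_dual_apply_eq_pair h.finrank_eq huv, Finset.card_image_of_injective]
      · simp [sq]
      · rintro ⟨a, b⟩ ⟨a', b'⟩ hab
        have := LinearIndependent.pair_iff.1 hli (a - a') (b - b') (by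
          rw [sub_smul, sub_smul]
          have hab' : a • d + b • e = a' • d + b' • e := hab
          rw [sub_add_sub_comm, hab', sub_self])
        rw [Prod.mk.injEq]
        exact ⟨sub_eq_zero.1 this.1, sub_eq_zero.1 this.2⟩
  have hfull : ∀ y : Dual K U, y u = x u → y v = x v → y ∈ X := by
    intro y hyu hyv
    have hmem : y - x ∈ univ.filter fun y : Dual K U => y u = 0 ∧ y v = 0 := by
      simp [hyu, hyv]
    rw [← hspan] at hmem
    obtain ⟨p, _, hp⟩ := Finset.mem_image.1 hmem
    by_contra hyX
    apply hcyl y (hyu.trans hxu) hyX (-p.1)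
    have : y + (-p.1) • d = x + p.2 • e := by
      ext w
      have hw := LinearMap.congr_fun hp w
      simp only [LinearMap.add_apply, LinearMap.sub_apply, LinearMap.smul_apply,
        smul_eq_mul] at hw ⊢
      linear_combination -hw
    rw [this]
    exact hex p.2
  obtain ⟨h1, h2, h3⟩ := h.isLinearOn_of_plane_subset huv hfull
  exact ⟨u, v, huv, h3, h1, h2⟩

end IsTwoIntersectionSet

end

/-! ### The square of `φ` is a quadratic form -/

section

open Finset Module

/-- A homogeneous function `φ` such that the lines through a given point of the projective space of
`U` on which `φ` is linear are the lines of a plane through that point. -/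
structure HasPolarPlanes {K U : Type*} [Field K] [AddCommGroup U] [Module K U] (φ : U → K) :
    Prop where
  map_smul : ∀ (c : K) (u : U), φ (c • u) = c * φ u
  exists_dual : ∀ u ≠ 0, ∃ d : Dual K U, d ≠ 0 ∧ ∀ v, IsLinearOn φ u v ↔ d v = 0

namespace HasPolarPlanes

variable {K U : Type*} [Field K] [AddCommGroup U] [Module K U] {φ : U → K}

theorem isLinearOn_zero (h : HasPolarPlanes φ) (v : U) : IsLinearOn φ 0 v := by
  intro a b
  have h0 : φ 0 = 0 := by simpa using h.map_smul 0 0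
  simp [h0, h.map_smul]

theorem isLinearOn_self (h : HasPolarPlanes φ) (u : U) : IsLinearOn φ u u := by
  intro a b
  rw [← add_smul, h.map_smul]
  ring

theorem isLinearOn_add (h : HasPolarPlanes φ) {u v w : U} (hv : IsLinearOn φ u v)
    (hw : IsLinearOn φ u w) : IsLinearOn φ u (v + w) := by
  by_cases hu : u = 0
  · rw [hu]; exact h.isLinearOn_zero _
  · obtain ⟨d, _, hd⟩ := h.exists_dual u hu
    rw [hd] at *
    rw [map_add, hv, hw, add_zero]

theorem isLinearOn_smul (h : HasPolarPlanes φ) {u v : U} (hv : IsLinearOn φ u v) (c : K) :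
    IsLinearOn φ u (c • v) := by
  by_cases hu : u = 0
  · rw [hu]; exact h.isLinearOn_zero _
  · obtain ⟨d, _, hd⟩ := h.exists_dual u hu
    rw [hd] at *
    rw [_root_.map_smul, hv, smul_zero]

theorem isLinearOn_of_smul (h : HasPolarPlanes φ) {u v : U} {c : K} (hc : c ≠ 0)
    (hv : IsLinearOn φ u (c • v)) : IsLinearOn φ u v := by
  simpa [smul_smul, hc] using h.isLinearOn_smul hv c⁻¹

theorem isLinearOn_of_add (h : HasPolarPlanes φ) {u v w : U} (hv : IsLinearOn φ u v)
    (hw : IsLinearOn φ u (v + w)) : IsLinearOn φ u w := by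
  simpa using h.isLinearOn_add hw (h.isLinearOn_smul hv (-1))

/-- There is a symplectic frame for the relation `IsLinearOn φ`. -/
theorem exists_frame (h : HasPolarPlanes φ) (hU : finrank K U = 4) :
    ∃ e f e' f' : U, LinearIndependent K ![e, f, e', f'] ∧ IsLinearOn φ e e' ∧ IsLinearOn φ e f' ∧
      IsLinearOn φ f e' ∧ IsLinearOn φ f f' ∧ ¬ IsLinearOn φ e f ∧ ¬ IsLinearOn φ e' f' := by
  have hfin : FiniteDimensional K U := FiniteDimensional.of_finrank_pos (by rw [hU]; simp)
  have : Nontrivial U := Module.nontrivial_of_finrank_pos (R := K) (by rw [hU]; simp)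
  obtain ⟨e, he⟩ := exists_ne (0 : U)
  obtain ⟨d, hd, hde⟩ := h.exists_dual e he
  obtain ⟨f, hf⟩ : ∃ f, d f ≠ 0 := by
    by_contra! hcon
    exact hd (LinearMap.ext hcon)
  have hef : ¬ IsLinearOn φ e f := by rwa [hde]
  have hf0 : f ≠ 0 := by rintro rfl; simp at hf
  obtain ⟨d', hd', hdf⟩ := h.exists_dual f hf0
  have hfe : d' e ≠ 0 := by
    rw [Ne, ← hdf]
    exact fun hl => hef hl.symm
  -- the intersection of the two polar planes is a line
  obtain ⟨e', f', hli, ⟨h1, h2⟩, h3, h4⟩ : ∃ e' f' : U, LinearIndependent K ![e', f'] ∧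
      (d e' = 0 ∧ d' e' = 0) ∧ d f' = 0 ∧ d' f' = 0 := by
    have hrank : 2 ≤ finrank K (LinearMap.ker (d.prod d')) := by
      have h1 := LinearMap.finrank_range_add_finrank_ker (d.prod d')
      have h2 := Submodule.finrank_le (LinearMap.range (d.prod d'))
      rw [Module.finrank_prod, Module.finrank_self] at h2
      omega
    obtain ⟨b, hb⟩ := exists_linearIndependent_of_le_finrank hrank
    refine ⟨b 0, b 1, ?_, ?_, ?_⟩
    · have := hb.map' (LinearMap.ker (d.prod d')).subtype (Submodule.ker_subtype _)
      have hcomp : (LinearMap.ker (d.prod d')).subtype ∘ b = ![(b 0 : U), (b 1 : U)] := by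
        ext i
        fin_cases i <;> rfl
      rw [hcomp] at this
      exact this
    · simpa using (b 0).2
    · simpa using (b 1).2
  have hdee : d e = 0 := (hde e).1 (h.isLinearOn_self e)
  have hdff : d' f = 0 := (hdf f).1 (h.isLinearOn_self f)
  have hindep : LinearIndependent K ![e, f, e', f'] := by
    rw [Fintype.linearIndependent_iff]
    intro g hg
    simp only [Fin.sum_univ_four, Matrix.cons_val_zero, Matrix.cons_val_one, Matrix.cons_val] at hg
    have g1 : g 1 = 0 := by
      have := congrArg d hg
      simpa [hdee, h1, h3, hf] using this
    have g0 : g 0 = 0 := by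
      have := congrArg d' hg
      simpa [hdff, h2, h4, hfe] using this
    rw [g0, g1, zero_smul, zero_smul, zero_add, zero_add] at hg
    obtain ⟨g2, g3⟩ := LinearIndependent.pair_iff.1 hli _ _ hg
    intro i
    fin_cases i <;> assumption
  have l1 := (hde e').2 h1
  have l2 := (hde f').2 h3
  have l3 := (hdf e').2 h2
  have l4 := (hdf f').2 h4
  refine ⟨e, f, e', f', hindep, l1, l2, l3, l4, hef, fun hl => ?_⟩
  have he' : e' ≠ 0 := hli.ne_zero 0
  obtain ⟨d'', hd'', hde'⟩ := h.exists_dual e' he'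
  apply hd''
  refine (basisOfLinearIndependentOfCardEqFinrank hindep (by simp [hU])).ext fun i => ?_
  rw [coe_basisOfLinearIndependentOfCardEqFinrank]
  fin_cases i
  · exact (hde' _).1 l1.symm
  · exact (hde' _).1 l3.symm
  · exact (hde' _).1 (h.isLinearOn_self _)
  · exact (hde' _).1 hl

/-- In a symplectic frame, suitably scaled, `e + s e'` and `s f + f'` are orthogonal for
the relation `IsLinearOn φ`, as they are for the symplectic form of the frame. -/
theorem exists_scaled_frame [CharP K 2] (h : HasPolarPlanes φ) (hU : finrank K U = 4) :
    ∃ e f e' f' : U, LinearIndependent K ![e, f, e', f'] ∧ IsLinearOn φ e e' ∧ IsLinearOn φ e f' ∧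
      IsLinearOn φ f e' ∧ IsLinearOn φ f f' ∧ ¬ IsLinearOn φ e f ∧
      ∀ s : K, IsLinearOn φ (e + s • e') (s • f + f') := by
  obtain ⟨e, f, e', f', hli, l1, l2, l3, l4, n1, n2⟩ := h.exists_frame hU
  have hτ : ∀ s : K, ∃ t : K, IsLinearOn φ (e + s • e') (t • f + f') := by
    intro s
    have hne : e + s • e' ≠ 0 := by
      intro h0
      have := Fintype.linearIndependent_iff.1 hli ![1, 0, s, 0]
        (by simpa [Fin.sum_univ_four] using h0) 0
      simp at this
    obtain ⟨d, _, hd⟩ := h.exists_dual _ hne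
    have hdf : d f ≠ 0 := by
      rw [Ne, ← hd]
      intro hl
      refine n1 (IsLinearOn.symm (h.isLinearOn_of_add (h.isLinearOn_smul l3 s) ?_))
      rw [add_comm]
      exact hl.symm
    refine ⟨-(d f' / d f), ?_⟩
    rw [hd, map_add, _root_.map_smul, smul_eq_mul]
    field_simp
    ring
  choose τ hτ using hτ
  have hself : ∀ v : U, v + v = 0 := fun v => by
    rw [← two_smul K, CharTwo.two_eq_zero, zero_smul]
  -- the polar plane of `e + f'` contains all the vectors `s e' + τ s f`
  have hW : ∀ s : K, IsLinearOn φ (e + f') (s • e' + τ s • f) := by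
    intro s
    have y1 : IsLinearOn φ (τ s • f + f') (e + s • e' + τ s • f) :=
      h.isLinearOn_add (hτ s).symm (h.isLinearOn_smul
        (IsLinearOn.symm (h.isLinearOn_add (h.isLinearOn_smul (h.isLinearOn_self f) _) l4)) _)
    have y2 : IsLinearOn φ (e + s • e' + τ s • f) (s • e') :=
      h.isLinearOn_smul (IsLinearOn.symm (h.isLinearOn_add (h.isLinearOn_add l1.symm
        (h.isLinearOn_smul (h.isLinearOn_self e') s)) (h.isLinearOn_smul l3.symm _))) _
    have y3 := h.isLinearOn_add (h.isLinearOn_add (h.isLinearOn_self (e + s • e' + τ s • f))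
      y1.symm) y2
    have e1 : e + s • e' + τ s • f + (τ s • f + f') + s • e' = e + f' := by
      have : e + s • e' + τ s • f + (τ s • f + f') + s • e' =
          e + f' + (s • e' + s • e') + (τ s • f + τ s • f) := by abel
      rw [this, hself, hself, add_zero, add_zero]
    rw [e1] at y3
    have y4 : IsLinearOn φ (e + f') e := IsLinearOn.symm (h.isLinearOn_add (h.isLinearOn_self e) l2)
    refine h.isLinearOn_of_add y4 ?_
    rw [← add_assoc]
    exact y3.symm
  have hlin : ∀ s, τ s = s * τ 1 := by
    intro s
    by_contra hne
    have y1 := h.isLinearOn_add (hW s) (h.isLinearOn_smul (hW 1) (-s))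
    have e1 : s • e' + τ s • f + (-s) • ((1 : K) • e' + τ 1 • f) = (τ s - s * τ 1) • f := by
      module
    rw [e1] at y1
    have y2 := h.isLinearOn_of_smul (sub_ne_zero.2 hne) y1
    refine n1 (IsLinearOn.symm (h.isLinearOn_of_add l4 ?_))
    rw [add_comm]
    exact y2.symm
  have hτ1 : τ 1 ≠ 0 := by
    intro h0
    have y := hτ 1
    rw [h0, zero_smul, zero_add, one_smul] at y
    exact n2 (IsLinearOn.symm (h.isLinearOn_of_add l2.symm y.symm))
  refine ⟨e, τ 1 • f, e', f', ?_, l1, l2, (h.isLinearOn_smul l3.symm _).symm,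
    (h.isLinearOn_smul l4.symm _).symm, fun hl => n1 (h.isLinearOn_of_smul hτ1 hl), fun s => ?_⟩
  · rw [Fintype.linearIndependent_iff] at hli ⊢
    intro g hg
    have := hli ![g 0, g 1 * τ 1, g 2, g 3]
      (by simpa [Fin.sum_univ_four, mul_smul] using hg)
    intro i
    fin_cases i
    · exact this 0
    · simpa [hτ1] using this 1
    · exact this 2
    · exact this 3
  · rw [smul_smul, ← hlin]
    exact hτ s

/-- In a scaled symplectic frame the orthogonality relations between `e + s e'` and `s f + f'`
become a functional equation for `φ` on the two hyperbolic lines, with `C √(a b)` as the only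
solution up to a linear function. -/
theorem sq_apply_frame [Finite K] [CharP K 2] (h : HasPolarPlanes φ) {e f e' f' : U}
    (l1 : IsLinearOn φ e e') (l2 : IsLinearOn φ e f') (l3 : IsLinearOn φ f e')
    (l4 : IsLinearOn φ f f') (n : ¬ IsLinearOn φ e f)
    (hs : ∀ s : K, IsLinearOn φ (e + s • e') (s • f + f')) :
    ∃ C : K, C ≠ 0 ∧ ∀ a b c d : K, φ (a • e + b • f + c • e' + d • f') ^ 2 =
      (a * φ e + b * φ f + c * φ e' + d * φ f') ^ 2 + C ^ 2 * (a * b + c * d) := by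
  have two : (2 : K) = 0 := CharTwo.two_eq_zero
  have hsplit : ∀ a b c d : K, φ (a • e + b • f + c • e' + d • f') =
      φ (a • e + b • f) + φ (c • e' + d • f') := by
    intro a b c d
    have y : IsLinearOn φ (a • e + b • f) (c • e' + d • f') := by
      refine h.isLinearOn_add (h.isLinearOn_smul ?_ _) (h.isLinearOn_smul ?_ _) <;>
      refine IsLinearOn.symm (h.isLinearOn_add (h.isLinearOn_smul ?_ _) (h.isLinearOn_smul ?_ _))
      exacts [l1.symm, l3.symm, l2.symm, l4.symm]
    have := y 1 1
    simpa [add_assoc] using this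
  set g : K → K → K := fun a b => φ (a • e + b • f) - (a * φ e + b * φ f) with hg
  set k : K → K → K := fun c d => φ (c • e' + d • f') - (c * φ e' + d * φ f') with hk
  have hgh : ∀ t a b, g (t * a) (t * b) = t * g a b := by
    intro t a b
    have : (t * a) • e + (t * b) • f = t • (a • e + b • f) := by module
    simp only [hg, this, h.map_smul]
    ring
  -- `φ` is linear on the span of `e + s e'` and `s f + f'`
  have hfun : ∀ a b s, g a (b * s) + k (a * s) b = 0 := by
    intro a b s
    have y := hs s a b
    have e1 : a • (e + s • e') + b • (s • f + f') =
        a • e + (b * s) • f + (a * s) • e' + b • f' := by module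
    have y1 := hs s 1 0
    have y2 := hs s 0 1
    have z1 := l1 1 s
    have z2 := l4 s 1
    simp only [one_smul, one_mul] at z1 z2
    rw [e1, hsplit, z1, z2] at y
    simp only [hg, hk]
    linear_combination y
  have hfun' : ∀ a b s, k (a * s) b = g a (b * s) := by
    intro a b s
    linear_combination hfun a b s - g a (b * s) * two
  have hprod : ∀ a b, g a b = g 1 (a * b) := by
    intro a b
    have y1 := hfun' a 1 b
    have y2 := hfun' 1 1 (a * b)
    rw [one_mul] at y1 y2
    rw [← y1, ← y2]
  have hkprod : ∀ c d, k c d = g 1 (c * d) := by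
    intro c d
    have := hfun' 1 d c
    rw [one_mul] at this
    rw [this, mul_comm]
  have hsq : ∀ x, g 1 x ^ 2 = g 1 1 ^ 2 * x := by
    intro x
    obtain ⟨r, rfl⟩ := FiniteField.isSquare_of_char_two (ringChar.eq K 2) x
    have y := hgh r 1 1
    rw [mul_one, hprod] at y
    rw [y]
    ring
  refine ⟨g 1 1, ?_, ?_⟩
  · intro h0
    apply n
    intro a b
    have y1 := hsq (a * b)
    rw [h0, ← hprod] at y1
    have y2 : g a b = 0 := by simpa using y1
    exact sub_eq_zero.1 y2
  · intro a b c d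
    have y1 := hsq (a * b)
    have y2 := hsq (c * d)
    rw [← hprod] at y1
    rw [← hkprod] at y2
    have y3 : φ (a • e + b • f) = g a b + (a * φ e + b * φ f) := by simp [hg]
    have y4 : φ (c • e' + d • f') = k c d + (c * φ e' + d * φ f') := by simp [hk]
    rw [hsplit, y3, y4, mul_add, ← y1, ← y2]
    linear_combination (g a b * k c d + (g a b + k c d) *
      (a * φ e + b * φ f + (c * φ e' + d * φ f'))) * two

/-- The square of `φ` is a quadratic form with non-degenerate polar form. -/
theorem exists_quadraticForm [Finite K] [CharP K 2] (h : HasPolarPlanes φ)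
    (hU : finrank K U = 4) : ∃ G : QuadraticForm K U, (∀ u, G u = φ u ^ 2) ∧
      ∀ v, (∀ w, QuadraticMap.polar G v w = 0) → v = 0 := by
  obtain ⟨e, f, e', f', hli, l1, l2, l3, l4, n, hs⟩ := h.exists_scaled_frame hU
  obtain ⟨C, hC, hφ⟩ := h.sq_apply_frame l1 l2 l3 l4 n hs
  set b := basisOfLinearIndependentOfCardEqFinrank hli (by simp [hU]) with hb
  have hrepr : ∀ v, v = b.repr v 0 • e + b.repr v 1 • f + b.repr v 2 • e' + b.repr v 3 • f' := by
    intro v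
    conv_lhs => rw [← b.sum_repr v]
    simp [Fin.sum_univ_four, hb]
  set L : U →ₗ[K] K := φ e • b.coord 0 + φ f • b.coord 1 + φ e' • b.coord 2 + φ f' • b.coord 3
    with hL
  refine ⟨QuadraticMap.linMulLin L L + C ^ 2 • (QuadraticMap.linMulLin (b.coord 0) (b.coord 1) +
    QuadraticMap.linMulLin (b.coord 2) (b.coord 3)), ?_, ?_⟩
  · intro u
    conv_rhs => rw [hrepr u, hφ]
    simp [hL]
    ring
  · intro v hv
    have two : (2 : K) = 0 := CharTwo.two_eq_zero
    have hpol : ∀ w, C ^ 2 * (b.repr v 0 * b.repr w 1 + b.repr v 1 * b.repr w 0 +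
        (b.repr v 2 * b.repr w 3 + b.repr v 3 * b.repr w 2)) = 0 := by
      intro w
      have y := hv w
      simp only [QuadraticMap.polar, add_apply, smul_apply,
        QuadraticMap.linMulLin_apply, map_add, Basis.coord_apply, smul_eq_mul] at y
      linear_combination y - L v * L w * two
    have key : ∀ i, b.repr v i = 0 := by
      intro i
      fin_cases i
      · simpa [hC] using hpol (b 1)
      · simpa [hC] using hpol (b 0)
      · simpa [hC] using hpol (b 3)
      · simpa [hC] using hpol (b 2)
    rw [hrepr v, key, key, key, key]
    simp

end HasPolarPlanes

end

/-! ### The number of solids and the nucleus -/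

section

open Finset Module

section Arithmetic

theorem two_pow_dvd_of_pow_dvd {e : ℕ} {q N a b c : ℤ} (hq : q = 2 ^ e) (ha : Odd a)
    (hc : Odd c) (hdvd : q ^ 4 ∣ c * (N * (N * a - q ^ 3 * b))) : q ^ 2 ∣ N := by
  have key : ∀ i ≤ 2 * e, (2 : ℤ) ^ i ∣ N := by
    intro i
    induction i with
    | zero => simp
    | succ i ih =>
      intro hi
      obtain ⟨M, rfl⟩ := ih (by omega)
      obtain ⟨r, hr⟩ : ∃ r, 3 * e = i + 1 + r := ⟨3 * e - (i + 1), by omega⟩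
      obtain ⟨s, hs⟩ : ∃ s, 4 * e = 2 * i + 1 + s := ⟨4 * e - (2 * i + 1), by omega⟩
      have hq3 : q ^ 3 = 2 ^ i * (2 * 2 ^ r) := by
        rw [hq, ← pow_mul, mul_comm e 3, hr]; ring
      have hq4 : q ^ 4 = 2 ^ i * 2 ^ i * (2 * 2 ^ s) := by
        rw [hq, ← pow_mul, mul_comm e 4, hs]; ring
      have h1 : c * (2 ^ i * M * (2 ^ i * M * a - q ^ 3 * b)) =
          2 ^ i * 2 ^ i * (c * (M * (M * a - 2 * (2 ^ r * b)))) := by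
        rw [hq3]; ring
      rw [h1, hq4] at hdvd
      have h2 := Int.dvd_of_mul_dvd_mul_left (by positivity) hdvd
      have h3 : (2 : ℤ) ∣ c * (M * (M * a - 2 * (2 ^ r * b))) := (Dvd.intro _ rfl).trans h2
      rw [pow_succ]
      refine mul_dvd_mul_left _ ?_
      have h4 := even_iff_two_dvd.2 h3
      simp only [Int.even_mul, Int.even_sub, even_two, true_or, iff_true] at h4
      rw [← Int.not_even_iff_odd] at ha hc
      exact even_iff_two_dvd.1 (by tauto)
  have := key (2 * e) le_rfl
  rwa [hq, ← pow_mul, mul_comm e 2]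

/-- The standard equations for the numbers `x`, `y`, `z` of non-zero vectors on `0`, `q³/2` and
`(q³ + q²)/2` solids determine the number `N / 2` of solids. -/
theorem standard_equations {e : ℕ} (he : 0 < e) {q N x y z : ℤ} (hq : q = 2 ^ e)
    (hN : 0 < N) (hx : 0 ≤ x) (hy : 0 ≤ y) (hz : 0 ≤ z) (h0 : x + y + z = q ^ 5 - 1)
    (h1 : y * q ^ 3 + z * (q ^ 3 + q ^ 2) = N * (q ^ 4 - 1))
    (h2 : y * (q ^ 3) ^ 2 + z * (q ^ 3 + q ^ 2) ^ 2 =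
      N ^ 2 * (q ^ 3 - 1) + 2 * N * (q ^ 4 - q ^ 3)) :
    N = q ^ 4 + q ^ 2 ∧ 0 < x := by
  have hq2 : 2 ≤ q := by
    rw [hq]
    calc (2 : ℤ) = 2 ^ 1 := by norm_num
      _ ≤ 2 ^ e := pow_le_pow_right₀ (by norm_num) he
  have hqe : Even q := by rw [hq]; exact (even_two).pow_of_ne_zero he.ne'
  obtain ⟨u, rfl⟩ : q ^ 2 ∣ N := by
    refine two_pow_dvd_of_pow_dvd hq (a := q ^ 2 + q + 1) (b := q ^ 3 + q ^ 2 + q - 1)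
      (c := q - 1) ?_ (hqe.sub_odd odd_one) ⟨z * (q + 1), ?_⟩
    · exact ((hqe.pow_of_ne_zero two_ne_zero).add hqe).add_odd odd_one
    · linear_combination q ^ 3 * h1 - h2
  have hqp : 0 < q ^ 2 := by positivity
  have hu : 0 < u := pos_of_mul_pos_right hN hqp.le
  have hq4 : q ^ 4 ≠ 0 := by positivity
  have ez : z * (q + 1) = (q - 1) * (u * (u * (q ^ 2 + q + 1) - q * (q ^ 3 + q ^ 2 + q - 1))) := by
    apply mul_left_cancel₀ hq4
    linear_combination h2 - q ^ 3 * h1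
  have ey : y * q = (q - 1) * (u * ((q + 1) * (q ^ 3 + q ^ 2 + q + 1) - 2 * q -
      u * (q ^ 2 + q + 1))) := by
    apply mul_left_cancel₀ hq4
    linear_combination (q ^ 3 + q ^ 2) * h1 - h2
  have ex : x * (q * (q + 1)) = (q - 1) * (q * (q + 1) +
      (u - q ^ 2 - 1) * ((q ^ 2 + q + 1) * (u - q ^ 2 - q + 1) - 1)) := by
    apply mul_left_cancel₀ hq4
    linear_combination q ^ 3 * (q ^ 3 + q ^ 2) * h0 - (2 * q ^ 3 + q ^ 2) * h1 + h2
  have hq1 : 0 < q - 1 := by linarith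
  have lo : q ^ 2 ≤ u := by
    have b1 : 0 ≤ u * (u * (q ^ 2 + q + 1) - q * (q ^ 3 + q ^ 2 + q - 1)) := by
      refine nonneg_of_mul_nonneg_right ?_ hq1
      rw [← ez]; positivity
    have b2 := nonneg_of_mul_nonneg_right b1 hu
    by_contra hlt
    have : (q ^ 2 - 1 - u) * (q ^ 2 + q + 1) ≥ 0 := mul_nonneg (by linarith) (by positivity)
    nlinarith
  have hi : u ≤ q ^ 2 + q - 1 := by
    have b1 : 0 ≤ u * ((q + 1) * (q ^ 3 + q ^ 2 + q + 1) - 2 * q - u * (q ^ 2 + q + 1)) := by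
      refine nonneg_of_mul_nonneg_right ?_ hq1
      rw [← ey]; positivity
    have b2 := nonneg_of_mul_nonneg_right b1 hu
    by_contra hlt
    have : (u - q ^ 2 - q) * (q ^ 2 + q + 1) ≥ 0 := mul_nonneg (by linarith) (by positivity)
    nlinarith
  have hmain : u = q ^ 2 + 1 := by
    by_contra hne
    rcases eq_or_lt_of_le lo with rfl | lo
    · -- `u = q²` would give `q + 1 ∣ q³ - 1`
      have e1 : x * (q + 1) = q ^ 3 - 1 := by
        have hq0 : q ≠ 0 := by positivity
        apply mul_left_cancel₀ hq0
        linear_combination ex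
      have e2 : q + 1 ∣ 2 := ⟨q ^ 2 - q + 1 - x, by linear_combination e1⟩
      have := Int.le_of_dvd two_pos e2
      linarith
    · have lo' : q ^ 2 + 2 ≤ u := by
        rcases lt_or_gt_of_ne hne with hlt | hgt
        · linarith
        · linarith
      rcases eq_or_lt_of_le hi with rfl | hi
      · -- `u = q² + q - 1` would give `q ∣ 2`
        have e2 : q ∣ 2 := ⟨q ^ 2 - q + 2 - x * (q + 1), by linear_combination ex⟩
        have := Int.le_of_dvd two_pos e2
        linarith
      · -- in between, `x` would be negative
        have e1 : 0 ≤ q * (q + 1) +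
            (u - q ^ 2 - 1) * ((q ^ 2 + q + 1) * (u - q ^ 2 - q + 1) - 1) := by
          refine nonneg_of_mul_nonneg_right ?_ hq1
          rw [← ex]; positivity
        have e2 : (q ^ 2 + q + 1) * (u - q ^ 2 - q + 1) ≤ (q ^ 2 + q + 1) * (-1) := by
          refine mul_le_mul_of_nonneg_left (by linarith) (by positivity)
        have e3 : (u - q ^ 2 - 1) * ((q ^ 2 + q + 1) * (u - q ^ 2 - q + 1) - 1) ≤
            1 * ((q ^ 2 + q + 1) * (u - q ^ 2 - q + 1) - 1) :=
          mul_le_mul_of_nonpos_right (by linarith) (by nlinarith)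
        linarith
  subst hmain
  refine ⟨by ring, ?_⟩
  have e1 : 0 < x * (q * (q + 1)) := by
    rw [ex]
    have : (0 : ℤ) < (q - 1) * (q * (q + 1)) := by positivity
    linarith
  exact pos_of_mul_pos_left e1 (by positivity)

end Arithmetic

section Solids

open scoped Classical

variable {K V : Type*} [Field K] [AddCommGroup V] [Module K V] [Fintype V]

theorem finrank_inf_of_ne (hV : finrank K V = 5) {S T : Submodule K V} (hS : finrank K S = 4)
    (hT : finrank K T = 4) (hST : S ≠ T) : finrank K (S ⊓ T : Submodule K V) = 3 := by
  have h1 := Submodule.finrank_sup_add_finrank_inf_eq S T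
  have h2 : finrank K (S ⊔ T : Submodule K V) ≤ 5 := hV ▸ Submodule.finrank_le _
  have h3 : finrank K S < finrank K (S ⊔ T : Submodule K V) := by
    refine Submodule.finrank_lt_finrank_of_lt (lt_of_le_of_ne le_sup_left fun h => hST ?_)
    have hTS : T ≤ S := by rw [h]; exact le_sup_right
    exact (Submodule.eq_of_le_of_finrank_eq hTS (by rw [hS, hT])).symm
  omega

variable [Fintype K]

theorem card_mem_submodule {r : ℕ} {S : Submodule K V} (hS : finrank K S = r) :
    #{v : V | v ∈ S} = Fintype.card K ^ r := by
  rw [← hS, ← Module.card_eq_pow_finrank (K := K) (V := S), Fintype.card_subtype]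

theorem sum_card_solids (F : Finset (Submodule K V)) (hF : ∀ S ∈ F, finrank K S = 4) :
    ∑ v : V, #{S ∈ F | v ∈ S} = #F * Fintype.card K ^ 4 := by
  simp_rw [Finset.card_filter]
  rw [Finset.sum_comm]
  simp_rw [← Finset.card_filter]
  rw [Finset.sum_congr rfl (fun S hS => card_mem_submodule (hF S hS))]
  simp

theorem sum_card_solids_sq (hV : finrank K V = 5) (F : Finset (Submodule K V))
    (hF : ∀ S ∈ F, finrank K S = 4) :
    ∑ v : V, (#{S ∈ F | v ∈ S} : ℤ) ^ 2 =
      #F * (Fintype.card K : ℤ) ^ 4 + #F * (#F - 1) * (Fintype.card K : ℤ) ^ 3 := by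
  have h1 : ∀ v : V, (#{S ∈ F | v ∈ S} : ℤ) ^ 2 =
      ∑ S ∈ F, ∑ T ∈ F, if v ∈ S ∧ v ∈ T then 1 else 0 := by
    intro v
    rw [sq, Finset.card_filter]
    push_cast
    rw [Finset.sum_mul_sum]
    refine Finset.sum_congr rfl fun S _ => Finset.sum_congr rfl fun T _ => ?_
    split_ifs <;> simp_all
  have h2 : ∀ S ∈ F, ∑ v : V, ∑ T ∈ F, (if v ∈ S ∧ v ∈ T then (1 : ℤ) else 0) =
      (Fintype.card K : ℤ) ^ 4 + (#F - 1) * (Fintype.card K : ℤ) ^ 3 := by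
    intro S hS
    rw [Finset.sum_comm, ← Finset.add_sum_erase _ _ hS]
    have h3 : ∀ T ∈ F.erase S, ∑ v : V, (if v ∈ S ∧ v ∈ T then (1 : ℤ) else 0) =
        (Fintype.card K : ℤ) ^ 3 := by
      intro T hT
      have := finrank_inf_of_ne hV (hF S hS) (hF T (Finset.mem_of_mem_erase hT))
        (Finset.ne_of_mem_erase hT).symm
      rw [Finset.sum_boole]
      have h := card_mem_submodule this
      simp only [Submodule.mem_inf] at h
      exact_mod_cast h
    rw [Finset.sum_congr rfl h3, Finset.sum_const, Finset.card_erase_of_mem hS, nsmul_eq_mul,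
      Nat.cast_sub (Finset.card_pos.2 ⟨S, hS⟩)]
    simp only [and_self, Finset.sum_boole, card_mem_submodule (hF S hS)]
    push_cast
    ring
  rw [Finset.sum_congr rfl (fun v _ => h1 v), Finset.sum_comm, Finset.sum_congr rfl h2]
  simp
  ring

/-- The number of solids is `q²(q² + 1)/2`, and some point is on none of them. -/
theorem card_solids {e : ℕ} (he : 0 < e) (hq : Fintype.card K = 2 ^ e) (hV : finrank K V = 5)
    (F : Finset (Submodule K V)) (hF : ∀ S ∈ F, finrank K S = 4) (hne : F.Nonempty)
    (hI : ∀ v : V, v ≠ 0 → 2 * #{S ∈ F | v ∈ S} = 0 ∨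
      2 * #{S ∈ F | v ∈ S} = Fintype.card K ^ 3 ∨
      2 * #{S ∈ F | v ∈ S} = Fintype.card K ^ 3 + Fintype.card K ^ 2) :
    2 * #F = Fintype.card K ^ 4 + Fintype.card K ^ 2 ∧
      ∃ v : V, v ≠ 0 ∧ #{S ∈ F | v ∈ S} = 0 := by
  obtain ⟨q, hqq⟩ : ∃ q : ℤ, q = (Fintype.card K : ℤ) := ⟨_, rfl⟩
  have hqpos : 0 < q := by rw [hqq]; exact_mod_cast Fintype.card_pos (α := K)
  set k : V → ℤ := fun v => 2 * #{S ∈ F | v ∈ S} with hk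
  have hI' : ∀ v : V, v ≠ 0 → k v = 0 ∨ k v = q ^ 3 ∨ k v = q ^ 3 + q ^ 2 := by
    intro v hv
    rw [hqq]
    simp only [hk]
    exact_mod_cast hI v hv
  -- the numbers of vectors of the three kinds
  set x : ℤ := ∑ v ∈ univ.erase (0 : V), if k v = 0 then 1 else 0 with hx
  set y : ℤ := ∑ v ∈ univ.erase (0 : V), if k v = q ^ 3 then 1 else 0 with hy
  set z : ℤ := ∑ v ∈ univ.erase (0 : V), if k v = q ^ 3 + q ^ 2 then 1 else 0 with hz
  have n1 : (0 : ℤ) ≠ q ^ 3 := by positivity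
  have n2 : (0 : ℤ) ≠ q ^ 3 + q ^ 2 := by positivity
  have n3 : q ^ 3 ≠ q ^ 3 + q ^ 2 := by
    have : 0 < q ^ 2 := by positivity
    linarith
  have hsum : ∀ g : ℤ → ℤ, ∑ v ∈ univ.erase (0 : V), g (k v) =
      x * g 0 + y * g (q ^ 3) + z * g (q ^ 3 + q ^ 2) := by
    intro g
    rw [hx, hy, hz, Finset.sum_mul, Finset.sum_mul, Finset.sum_mul, ← Finset.sum_add_distrib,
      ← Finset.sum_add_distrib]
    refine Finset.sum_congr rfl fun v hv => ?_
    rcases hI' v (Finset.ne_of_mem_erase hv) with h | h | h <;>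
      simp [h, n1, n2, n3, n1.symm, n2.symm, n3.symm]
  have hk0 : k 0 = 2 * #F := by simp [hk]
  have s0 : ∑ v ∈ univ.erase (0 : V), (1 : ℤ) = q ^ 5 - 1 := by
    rw [Finset.sum_const, Finset.card_erase_of_mem (Finset.mem_univ _), Finset.card_univ,
      Module.card_eq_pow_finrank (K := K), hV, nsmul_eq_mul,
      Nat.cast_sub (Nat.one_le_pow _ _ Fintype.card_pos), hqq]
    push_cast; ring
  have s1 : ∑ v ∈ univ.erase (0 : V), k v = (2 * #F) * (q ^ 4 - 1) := by
    have h := congrArg (Nat.cast : ℕ → ℤ) (sum_card_solids F hF)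
    push_cast at h
    have h' : ∑ v, k v = 2 * #F * q ^ 4 := by
      simp only [hk]
      rw [← Finset.mul_sum, h, hqq]; ring
    rw [← Finset.add_sum_erase _ _ (Finset.mem_univ (0 : V)), hk0] at h'
    linear_combination h'
  have s2 : ∑ v ∈ univ.erase (0 : V), k v ^ 2 =
      (2 * #F) ^ 2 * (q ^ 3 - 1) + 2 * (2 * #F) * (q ^ 4 - q ^ 3) := by
    have h := sum_card_solids_sq hV F hF
    have h' : ∑ v, k v ^ 2 = 4 * (#F * q ^ 4 + #F * (#F - 1) * q ^ 3) := by
      simp only [hk, mul_pow]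
      rw [← Finset.mul_sum, h, hqq]; ring
    rw [← Finset.add_sum_erase _ _ (Finset.mem_univ (0 : V)), hk0] at h'
    linear_combination h'
  rw [hsum (fun _ => 1)] at s0
  rw [hsum (fun t => t)] at s1
  rw [hsum (fun t => t ^ 2)] at s2
  obtain ⟨hN, hxpos⟩ := standard_equations he (q := q) (N := 2 * #F) (x := x) (y := y) (z := z)
    (by rw [hqq, hq]; push_cast; rfl)
    (by have := hne.card_pos; positivity)
    (Finset.sum_nonneg fun _ _ => by split_ifs <;> norm_num)
    (Finset.sum_nonneg fun _ _ => by split_ifs <;> norm_num)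
    (Finset.sum_nonneg fun _ _ => by split_ifs <;> norm_num)
    (by linear_combination s0) (by linear_combination s1) (by linear_combination s2)
  refine ⟨by rw [hqq] at hN; exact_mod_cast hN, ?_⟩
  obtain ⟨v, hv, hv'⟩ := Finset.exists_ne_zero_of_sum_ne_zero hxpos.ne'
  refine ⟨v, Finset.ne_of_mem_erase hv, ?_⟩
  have : k v = 0 := by by_contra h0; simp [h0] at hv'
  simp only [hk] at this
  omega

end Solids

end

/-! ### Hyperbolic quadratic forms -/

section

open Finset Module

section Hyperbolic

variable {K W : Type*} [Field K] [AddCommGroup W] [Module K W]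

/-- A quadratic form on a four-dimensional space with non-degenerate polar form is hyperbolic as
soon as it vanishes on a two-dimensional subspace. -/
theorem equivalent_hyperbolicForm (hW : finrank K W = 4) (G : QuadraticForm K W)
    (hG : ∀ v, (∀ w, QuadraticMap.polar G v w = 0) → v = 0) {u v : W}
    (huv : LinearIndependent K ![u, v]) (h0 : ∀ a b : K, G (a • u + b • v) = 0) :
    G.Equivalent (hyperbolicForm K) := by
  have hfin : FiniteDimensional K W := FiniteDimensional.of_finrank_pos (by rw [hW]; simp)
  have hu : G u = 0 := by simpa using h0 1 0
  have hv : G v = 0 := by simpa using h0 0 1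
  have huv0 : QuadraticMap.polar G u v = 0 := by
    have := h0 1 1
    rw [one_smul, one_smul] at this
    simp [QuadraticMap.polar, this, hu, hv]
  have hli : LinearIndependent K ![G.polarBilin u, G.polarBilin v] := by
    rw [LinearIndependent.pair_iff] at huv ⊢
    intro s t hst
    refine huv s t (hG _ fun w => ?_)
    have := LinearMap.congr_fun hst w
    simpa [QuadraticMap.polar_add_left, QuadraticMap.polar_smul_left] using this
  obtain ⟨w₁, h11, h12⟩ := exists_apply_eq_pair hli 1 0
  obtain ⟨w₂, h21, h22⟩ := exists_apply_eq_pair hli 0 1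
  simp only [QuadraticMap.polarBilin_apply_apply] at h11 h12 h21 h22
  have hself : ∀ w : W, G w = 0 → QuadraticMap.polar G w w = 0 := by
    intro w hw
    simp [QuadraticMap.polar_self, hw]
  -- the second vector of each hyperbolic pair, made singular and orthogonal to the other pair
  obtain ⟨f, hf, huf, hvf⟩ : ∃ f, G f = 0 ∧ QuadraticMap.polar G u f = 1 ∧
      QuadraticMap.polar G v f = 0 := by
    refine ⟨w₁ + (-G w₁) • u, ?_, ?_, ?_⟩
    · have h11' : QuadraticMap.polar G w₁ u = 1 := by rw [QuadraticMap.polar_comm, h11]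
      simp [QuadraticMap.map_add, QuadraticMap.map_smul, QuadraticMap.polar_smul_right, h11', hu]
    · rw [QuadraticMap.polar_add_right, QuadraticMap.polar_smul_right, h11, hself u hu]
      simp
    · rw [QuadraticMap.polar_add_right, QuadraticMap.polar_smul_right, h12,
        QuadraticMap.polar_comm, huv0]
      simp
  obtain ⟨f', hf', huf', hvf', hff'⟩ : ∃ f', G f' = 0 ∧ QuadraticMap.polar G u f' = 0 ∧
      QuadraticMap.polar G v f' = 1 ∧ QuadraticMap.polar G f f' = 0 := by
    have hvu0 : QuadraticMap.polar G v u = 0 := by rw [QuadraticMap.polar_comm, huv0]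
    have hfu : QuadraticMap.polar G f u = 1 := by rw [QuadraticMap.polar_comm, huf]
    have hfv : QuadraticMap.polar G f v = 0 := by rw [QuadraticMap.polar_comm, hvf]
    have hw2u : QuadraticMap.polar G w₂ u = 0 := by rw [QuadraticMap.polar_comm, h21]
    have hw2v : QuadraticMap.polar G w₂ v = 1 := by rw [QuadraticMap.polar_comm, h22]
    refine ⟨w₂ + (-G w₂) • v + (-QuadraticMap.polar G f w₂) • u, ?_, ?_, ?_, ?_⟩
    · simp [QuadraticMap.map_add, QuadraticMap.map_smul, QuadraticMap.polar_smul_right,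
        QuadraticMap.polar_add_left, QuadraticMap.polar_smul_left, hu, hv, hw2u, hw2v, hvu0]
    · simp [QuadraticMap.polar_smul_right, QuadraticMap.polar_add_right, hself u hu, h21, huv0]
    · simp [QuadraticMap.polar_smul_right, QuadraticMap.polar_add_right, hself v hv, h22, hvu0]
    · simp [QuadraticMap.polar_smul_right, QuadraticMap.polar_add_right, hfu, hfv]
  have hvu0 : QuadraticMap.polar G v u = 0 := by rw [QuadraticMap.polar_comm, huv0]
  have hfu : QuadraticMap.polar G f u = 1 := by rw [QuadraticMap.polar_comm, huf]
  have hfv : QuadraticMap.polar G f v = 0 := by rw [QuadraticMap.polar_comm, hvf]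
  have hf'u : QuadraticMap.polar G f' u = 0 := by rw [QuadraticMap.polar_comm, huf']
  have hf'v : QuadraticMap.polar G f' v = 1 := by rw [QuadraticMap.polar_comm, hvf']
  have hf'f : QuadraticMap.polar G f' f = 0 := by rw [QuadraticMap.polar_comm, hff']
  have hindep : LinearIndependent K ![u, f, v, f'] := by
    rw [Fintype.linearIndependent_iff]
    intro g hg
    simp only [Fin.sum_univ_four, Matrix.cons_val_zero, Matrix.cons_val_one, Matrix.cons_val] at hg
    have hp : ∀ w, QuadraticMap.polar G (g 0 • u + g 1 • f + g 2 • v + g 3 • f') w = 0 := by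
      intro w; rw [hg]; simp
    simp only [QuadraticMap.polar_add_left, QuadraticMap.polar_smul_left, smul_eq_mul] at hp
    intro i
    fin_cases i
    · simpa [huf, hvf, hself f hf, hf'f] using hp f
    · simpa [hfu, hvu0, hself u hu, hf'u] using hp u
    · simpa [huf', hvf', hself f' hf', hff'] using hp f'
    · simpa [huv0, hfv, hself v hv, hf'v] using hp v
  set b := basisOfLinearIndependentOfCardEqFinrank hindep (by simp [hW]) with hb
  refine ⟨{ b.equivFun with map_app' := fun w => ?_ }⟩
  have hw : w = b.repr w 0 • u + b.repr w 1 • f + b.repr w 2 • v + b.repr w 3 • f' := by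
    conv_lhs => rw [← b.sum_repr w]
    simp [Fin.sum_univ_four, hb]
  conv_rhs => rw [hw]
  simp [hyperbolicForm, QuadraticMap.map_add, QuadraticMap.map_smul,
    QuadraticMap.polar_smul_right, QuadraticMap.polar_add_left, QuadraticMap.polar_smul_left,
    hu, hv, hf, hf', huf, huv0, hfv, huf', hff', hvf']
  ring

theorem sectionBy_quadricPoints (Q : QuadraticForm K W) (S : Submodule K W) :
    sectionBy (quadricPoints Q) S = quadricPoints (Q.comp S.subtype) := by
  ext P
  induction P using Projectivization.ind with
  | h s hs =>
    rw [sectionBy, Set.mem_preimage, Projectivization.map_mk, mk_mem_quadricPoints,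
      mk_mem_quadricPoints]
    rfl

end Hyperbolic

end

/-! ### Solids not containing a given point -/

section

open Finset Module

section Decomposition

variable {K V U : Type*} [Field K] [AddCommGroup V] [Module K V] [AddCommGroup U] [Module K U]

theorem exists_equiv_prod (hV : finrank K V = 5) {N : V} (hN : N ≠ 0) :
    ∃ Φ : V ≃ₗ[K] K × (Fin 4 → K), Φ N = (1, 0) := by
  have hfin : FiniteDimensional K V := FiniteDimensional.of_finrank_pos (by rw [hV]; simp)
  obtain ⟨C, hC⟩ := Submodule.exists_isCompl (K ∙ N)
  have hCr : finrank K C = finrank K (Fin 4 → K) := by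
    have := Submodule.finrank_add_eq_of_isCompl hC
    rw [finrank_span_singleton hN, hV] at this
    simp; omega
  refine ⟨(Submodule.prodEquivOfIsCompl _ _ hC).symm ≪≫ₗ
    (LinearEquiv.toSpanNonzeroSingleton K V N hN).symm.prodCongr
      (LinearEquiv.ofFinrankEq C (Fin 4 → K) hCr), ?_⟩
  have h1 : (Submodule.prodEquivOfIsCompl _ _ hC).symm N =
      (⟨N, Submodule.mem_span_singleton_self N⟩, 0) := by
    rw [LinearEquiv.symm_apply_eq]
    simp
  have h2 : (LinearEquiv.toSpanNonzeroSingleton K V N hN).symm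
      ⟨N, Submodule.mem_span_singleton_self N⟩ = 1 := by
    rw [LinearEquiv.symm_apply_eq]
    ext
    simp
  simp [h1, h2]

/-- The solid `{v | t = x u, where Φ v = (t, u)}`, with respect to a decomposition `Φ` of the space
into a line spanned by a vector `N` and a complement `U`. As `x` varies in the dual space of `U`,
these are the solids that do not contain `N`. -/
def graphSolid (Φ : V ≃ₗ[K] K × U) (x : Dual K U) : Submodule K V :=
  LinearMap.ker ((LinearMap.fst K K U - x ∘ₗ LinearMap.snd K K U) ∘ₗ Φ.toLinearMap)

variable (Φ : V ≃ₗ[K] K × U)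

theorem mem_graphSolid {x : Dual K U} {v : V} : v ∈ graphSolid Φ x ↔ (Φ v).1 = x (Φ v).2 := by
  simp [graphSolid, sub_eq_zero]

theorem symm_mem_graphSolid {x : Dual K U} {c : K} {u : U} :
    Φ.symm (c, u) ∈ graphSolid Φ x ↔ c = x u := by
  simp [mem_graphSolid]

theorem graphSolid_injective : Function.Injective (graphSolid Φ) := by
  intro x y hxy
  ext u
  rw [← symm_mem_graphSolid Φ, ← hxy, symm_mem_graphSolid Φ]

theorem finrank_graphSolid {r : ℕ} (hV : finrank K V = r + 1) (x : Dual K U) :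
    finrank K (graphSolid Φ x) = r := by
  have hfin : FiniteDimensional K V := FiniteDimensional.of_finrank_pos (by rw [hV]; simp)
  have hne : (LinearMap.fst K K U - x ∘ₗ LinearMap.snd K K U) ∘ₗ Φ.toLinearMap ≠ 0 := by
    intro h0
    have := LinearMap.congr_fun h0 (Φ.symm (1, 0))
    simp at this
  have h1 := Module.Dual.finrank_ker_add_one_of_ne_zero hne
  rw [hV] at h1
  exact Nat.succ_injective h1

theorem exists_eq_graphSolid {r : ℕ} (hV : finrank K V = r + 1) {N : V} (hN : Φ N = (1, 0))
    {S : Submodule K V} (hS : finrank K S = r) (hNS : N ∉ S) : ∃ x, S = graphSolid Φ x := by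
  have hfin : FiniteDimensional K V := FiniteDimensional.of_finrank_pos (by rw [hV]; simp)
  obtain ⟨f, hfN, hf⟩ := Submodule.exists_le_ker_of_notMem hNS
  refine ⟨-(f N)⁻¹ • (f ∘ₗ Φ.symm.toLinearMap ∘ₗ LinearMap.inr K K U),
    Submodule.eq_of_le_of_finrank_eq (fun v hv => ?_) (by rw [hS, finrank_graphSolid Φ hV])⟩
  have h1 : f v = 0 := hf hv
  have h2 : v = (Φ v).1 • N + Φ.symm (0, (Φ v).2) := by
    apply Φ.injective
    rw [map_add, map_smul, hN, LinearEquiv.apply_symm_apply]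
    ext <;> simp
  rw [h2, map_add, map_smul, smul_eq_mul] at h1
  rw [mem_graphSolid]
  simp only [LinearMap.smul_apply, LinearMap.comp_apply,
    LinearEquiv.coe_coe, LinearMap.inr_apply, smul_eq_mul]
  field_simp
  linear_combination h1

/-- The solids `graphSolid Φ y` that contain the plane in which two of them meet are given by the
points `y` of a line of the dual space. -/
theorem exists_smul_of_inf_le {x d y : Dual K U}
    (h : graphSolid Φ x ⊓ graphSolid Φ (x + d) ≤ graphSolid Φ y) : ∃ t : K, y = x + t • d := by
  have hker : ∀ u, d u = 0 → y u = x u := by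
    intro u hu
    have : Φ.symm (x u, u) ∈ graphSolid Φ x ⊓ graphSolid Φ (x + d) := by
      rw [Submodule.mem_inf, symm_mem_graphSolid, symm_mem_graphSolid]
      simp [hu]
    exact ((symm_mem_graphSolid Φ).1 (h this)).symm
  by_cases hd : d = 0
  · exact ⟨0, by ext u; simp [hker u (by simp [hd])]⟩
  · obtain ⟨w, hw⟩ := LinearMap.surjective hd 1
    refine ⟨y w - x w, ?_⟩
    ext u
    have h1 := hker (u - d u • w) (by simp [hw])
    simp only [map_sub, map_smul, smul_eq_mul] at h1
    simp only [LinearMap.add_apply, LinearMap.smul_apply, smul_eq_mul]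
    linear_combination h1

end Decomposition

/-- In a parallel class of `q` hyperplanes, of which each meets a set of `(q⁴ + q²)/2` points in
`0`, `q³/2` or `(q³ + q²)/2` points, there is exactly one of the greatest size, and none of
size `0`. -/
theorem exists_unique_large {K : Type*} [Fintype K] [DecidableEq K] [Nonempty K] {q : ℕ}
    (hq : Fintype.card K = q) (k : K → ℕ) (hsum : 2 * ∑ c, k c = q ^ 4 + q ^ 2)
    (hk : ∀ c, 2 * k c = 0 ∨ 2 * k c = q ^ 3 ∨ 2 * k c = q ^ 3 + q ^ 2) :
    ∃ c₀, ∀ c, 2 * k c = if c = c₀ then q ^ 3 + q ^ 2 else q ^ 3 := by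
  have hqpos : 0 < q := hq ▸ Fintype.card_pos
  have n1 : 0 < q ^ 3 := by positivity
  have n2 : 0 < q ^ 2 := by positivity
  have e0 : #{c | 2 * k c = 0} + #{c | 2 * k c = q ^ 3} + #{c | 2 * k c = q ^ 3 + q ^ 2} = q := by
    rw [← hq, ← Finset.card_univ, Finset.card_eq_sum_ones univ]
    simp_rw [Finset.card_filter]
    rw [← Finset.sum_add_distrib, ← Finset.sum_add_distrib]
    refine Finset.sum_congr rfl fun c _ => ?_
    rw [← Finset.card_eq_sum_ones, Finset.card_univ, hq]
    rcases hk c with h | h | h <;> split_ifs <;> omega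
  have e1 : #{c | 2 * k c = q ^ 3} * q ^ 3 + #{c | 2 * k c = q ^ 3 + q ^ 2} * (q ^ 3 + q ^ 2) =
      q ^ 4 + q ^ 2 := by
    rw [← hsum, Finset.mul_sum]
    simp_rw [Finset.card_filter]
    rw [Finset.sum_mul, Finset.sum_mul, ← Finset.sum_add_distrib]
    refine Finset.sum_congr rfl fun c _ => ?_
    rcases hk c with h | h | h <;> rw [h] <;> split_ifs <;> omega
  generalize #{c | 2 * k c = q ^ 3} = b at *
  generalize ha : #{c | 2 * k c = 0} = a at *
  obtain ⟨l, hl⟩ : ∃ l, l = #{c | 2 * k c = q ^ 3 + q ^ 2} := ⟨_, rfl⟩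
  rw [← hl] at e0 e1
  have e2 : b * q + l * (q + 1) = q ^ 2 + 1 := by
    refine Nat.eq_of_mul_eq_mul_left n2 ?_
    linarith
  have e3 : l = 1 + q * a := by
    have : (a + b + l) * q = q * q := by rw [e0]
    nlinarith
  have ha0 : a = 0 := by
    by_contra h0
    have : 1 ≤ a := Nat.one_le_iff_ne_zero.2 h0
    have : q * 1 ≤ q * a := Nat.mul_le_mul_left q this
    omega
  rw [ha0, mul_zero, add_zero] at e3
  rw [e3] at hl
  obtain ⟨c₀, hc₀⟩ := Finset.card_eq_one.1 hl.symm
  refine ⟨c₀, fun c => ?_⟩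
  have hc : 2 * k c = q ^ 3 + q ^ 2 ↔ c = c₀ := by
    rw [← Finset.mem_singleton (a := c₀), ← hc₀]; simp
  have hc' : 2 * k c ≠ 0 := by
    rw [ha0, Finset.card_eq_zero, Finset.filter_eq_empty_iff] at ha
    exact ha (Finset.mem_univ c)
  split_ifs with h
  · exact hc.2 h
  · have := hk c
    tauto

end

/-! ### From solids to the affine set, and from the quadratic form to the quadric -/

section

open Finset Module

section Reduction

open scoped Classical

variable {K : Type*} [Field K]

theorem numContaining_span [Finite K] (H : Set (Submodule K (PG4Space K))) (v : PG4Space K) :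
    numContaining H (K ∙ v) = #{S ∈ H.toFinite.toFinset | v ∈ S} := by
  rw [numContaining, ← Set.ncard_coe_finset]
  congr 1
  ext S
  simp

variable {U : Type*} [AddCommGroup U] [Module K U] [Fintype (Dual K U)]
  (Φ : PG4Space K ≃ₗ[K] K × U)

/-- The points `x` of the dual space of `U` for which `graphSolid Φ x` belongs to `H`. -/
noncomputable def dualPoints (H : Set (Submodule K (PG4Space K))) : Finset (Dual K U) :=
  {x | graphSolid Φ x ∈ H}

variable {H : Set (Submodule K (PG4Space K))} {N : PG4Space K}

theorem mem_dualPoints {x : Dual K U} : x ∈ dualPoints Φ H ↔ graphSolid Φ x ∈ H := by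
  simp [dualPoints]

variable [Fintype K]

theorem card_dualPoints_filter (hN : Φ N = (1, 0)) (hH : ∀ S ∈ H, IsSolid S)
    (hNH : ∀ S ∈ H, N ∉ S) (p : Dual K U → Prop) (P : Submodule K (PG4Space K) → Prop)
    (hp : ∀ x, p x ↔ P (graphSolid Φ x)) :
    #{x ∈ dualPoints Φ H | p x} = #{S ∈ H.toFinite.toFinset | P S} := by
  refine Finset.card_bij (fun x _ => graphSolid Φ x) ?_
    (fun x _ y _ h => graphSolid_injective Φ h) ?_
  · intro x hx
    simpa [mem_dualPoints, hp] using hx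
  · intro S hS
    simp only [Finset.mem_filter, Set.Finite.mem_toFinset] at hS
    obtain ⟨x, rfl⟩ := exists_eq_graphSolid Φ (r := 4) (by simp) hN (hH S hS.1) (hNH S hS.1)
    exact ⟨x, by simpa [mem_dualPoints, hp] using hS, rfl⟩

theorem numContaining_le_lineCount (hN : Φ N = (1, 0)) (hH : ∀ S ∈ H, IsSolid S)
    (hNH : ∀ S ∈ H, N ∉ S) (x d : Dual K U) :
    numContaining H (graphSolid Φ x ⊓ graphSolid Φ (x + d)) ≤
      lineCount K (dualPoints Φ H) x d := by
  have hsub : {S | S ∈ H ∧ graphSolid Φ x ⊓ graphSolid Φ (x + d) ≤ S} ⊆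
      (((univ.filter fun t : K => x + t • d ∈ dualPoints Φ H).image
        fun t => graphSolid Φ (x + t • d) : Finset (Submodule K (PG4Space K))) : Set _) := by
    rintro S ⟨hS, hle⟩
    obtain ⟨y, rfl⟩ := exists_eq_graphSolid Φ (r := 4) (by simp) hN (hH S hS) (hNH S hS)
    obtain ⟨t, rfl⟩ := exists_smul_of_inf_le Φ hle
    simp only [Finset.coe_image, Set.mem_image, Finset.mem_coe, Finset.mem_filter,
      Finset.mem_univ, true_and, mem_dualPoints]
    exact ⟨t, hS, rfl⟩
  calc numContaining H (graphSolid Φ x ⊓ graphSolid Φ (x + d))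
      ≤ _ := Set.ncard_le_ncard hsub (Finset.finite_toSet _)
    _ ≤ _ := by
      rw [Set.ncard_coe_finset]
      exact Finset.card_image_le

/-- If `N` lies on no solid of `H`, then the solids of `H` are points of an affine space; points off
`N` become its hyperplanes, and the planes in which two solids not through `N` meet its lines. -/
theorem exists_isTwoIntersectionSet {q : ℕ} (hq : Fintype.card K = q) (hU : finrank K U = 4)
    (hN : Φ N = (1, 0)) (hH : ∀ S ∈ H, IsSolid S) (hNH : ∀ S ∈ H, N ∉ S)
    (hcard : 2 * #H.toFinite.toFinset = q ^ 4 + q ^ 2)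
    (hI : ∀ v : PG4Space K, v ≠ 0 → 2 * #{S ∈ H.toFinite.toFinset | v ∈ S} = 0 ∨
      2 * #{S ∈ H.toFinite.toFinset | v ∈ S} = q ^ 3 ∨
      2 * #{S ∈ H.toFinite.toFinset | v ∈ S} = q ^ 3 + q ^ 2)
    (hII : ∀ π : Submodule K (PG4Space K), IsPlane π → (∃ S ∈ H, π ≤ S) →
      q ≤ 2 * numContaining H π) :
    ∃ φ : U → K, IsTwoIntersectionSet (dualPoints Φ H) φ := by
  have hpt : ∀ u c, #{x ∈ dualPoints Φ H | x u = c} =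
      #{S ∈ H.toFinite.toFinset | Φ.symm (c, u) ∈ S} := fun u c =>
    card_dualPoints_filter Φ hN hH hNH _ _ fun x => by rw [symm_mem_graphSolid, eq_comm]
  have hcardX : 2 * #(dualPoints Φ H) = q ^ 4 + q ^ 2 := by
    rw [← hcard]
    simpa using card_dualPoints_filter Φ hN hH hNH (fun _ => True) (fun _ => True) (by simp)
  have hφ : ∀ u : U, ∃ c₀, u ≠ 0 → ∀ c, 2 * #{x ∈ dualPoints Φ H | x u = c} =
      if c = c₀ then q ^ 3 + q ^ 2 else q ^ 3 := by
    intro u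
    by_cases hu : u = 0
    · exact ⟨0, fun h => absurd hu h⟩
    obtain ⟨c₀, hc₀⟩ := exists_unique_large hq (fun c => #{x ∈ dualPoints Φ H | x u = c})
      (by
        have hf := Finset.card_eq_sum_card_fiberwise (f := fun x : Dual K U => x u)
          (s := dualPoints Φ H) (t := univ) (by simp)
        rw [← hf, hcardX])
      (fun c => by
        simp only [hpt]
        exact hI _ (by simp [hu]))
    exact ⟨c₀, fun _ => hc₀⟩
  choose φ hφ using hφ
  refine ⟨fun u => if u = 0 then 0 else φ u, hU, by rw [hq, hcardX], ?_, ?_, by simp⟩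
  · intro u hu c
    rw [if_neg hu, hφ u hu, hq]
  · intro x hx d hd
    rw [hq]
    have hne : graphSolid Φ x ≠ graphSolid Φ (x + d) := fun h =>
      hd (by simpa using graphSolid_injective Φ h)
    have hV : finrank K (PG4Space K) = 4 + 1 := by simp
    refine (hII (graphSolid Φ x ⊓ graphSolid Φ (x + d)) ?_
      ⟨_, (mem_dualPoints Φ).1 hx, inf_le_left⟩).trans
      (Nat.mul_le_mul_left 2 (numContaining_le_lineCount Φ hN hH hNH x d))
    exact finrank_inf_of_ne hV (finrank_graphSolid Φ hV x) (finrank_graphSolid Φ hV _) hne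

end Reduction

section QuadricOfForm

variable {K V U : Type*} [Field K] [AddCommGroup V] [Module K V] [AddCommGroup U] [Module K U]
  (Φ : V ≃ₗ[K] K × U)

/-- The quadratic form `t² + G u`, where `Φ v = (t, u)`. -/
def extendForm (G : QuadraticForm K U) : QuadraticForm K V :=
  QuadraticMap.sq.comp (LinearMap.fst K K U ∘ₗ Φ.toLinearMap) +
    G.comp (LinearMap.snd K K U ∘ₗ Φ.toLinearMap)

theorem extendForm_apply (G : QuadraticForm K U) (v : V) :
    extendForm Φ G v = (Φ v).1 * (Φ v).1 + G (Φ v).2 := by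
  simp [extendForm]

variable [CharP K 2]

theorem polar_extendForm (G : QuadraticForm K U) (v w : V) :
    QuadraticMap.polar (extendForm Φ G) v w = QuadraticMap.polar G (Φ v).2 (Φ w).2 := by
  simp only [QuadraticMap.polar, extendForm_apply, map_add, Prod.fst_add, Prod.snd_add]
  linear_combination (Φ v).1 * (Φ w).1 * (CharTwo.two_eq_zero : (2 : K) = 0)

theorem extendForm_eq_zero_iff {G : QuadraticForm K U} {φ : U → K} (hG : ∀ u, G u = φ u ^ 2)
    (v : V) : extendForm Φ G v = 0 ↔ (Φ v).1 = φ (Φ v).2 := by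
  rw [extendForm_apply, hG, ← sq, ← CharTwo.add_sq, sq_eq_zero_iff, CharTwo.add_eq_zero]

theorem isNonsingularForm_extendForm {G : QuadraticForm K U}
    (hG : ∀ v, (∀ w, QuadraticMap.polar G v w = 0) → v = 0) :
    IsNonsingularForm (extendForm Φ G) := by
  intro v hv hpol
  have h1 : (Φ v).2 = 0 := hG _ fun w => by
    have := hpol (Φ.symm (0, w))
    rwa [polar_extendForm, LinearEquiv.apply_symm_apply] at this
  rw [extendForm_apply, h1, QuadraticMap.map_zero, add_zero, mul_self_eq_zero] at hv
  exact (LinearEquiv.map_eq_zero_iff Φ).1 (Prod.ext hv h1)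

/-- The solid given by `x` cuts out a hyperbolic quadric if the quadric contains a line of that
solid. -/
theorem isHyperbolicQuadric_graphSolid (hV : finrank K V = 5) {G : QuadraticForm K U} {φ : U → K}
    (hG : ∀ u, G u = φ u ^ 2) (hpol : ∀ v, (∀ w, QuadraticMap.polar G v w = 0) → v = 0)
    {x : Dual K U} {u v : U} (huv : LinearIndependent K ![u, v]) (hl : IsLinearOn φ u v)
    (hxu : x u = φ u) (hxv : x v = φ v) :
    IsHyperbolicQuadric (sectionBy (quadricPoints (extendForm Φ G)) (graphSolid Φ x)) := by
  refine ⟨_, ?_, sectionBy_quadricPoints _ _⟩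
  have hlift : ∀ w : U, Φ.symm (x w, w) ∈ graphSolid Φ x := fun w =>
    (symm_mem_graphSolid Φ).2 rfl
  refine equivalent_hyperbolicForm (finrank_graphSolid Φ hV x) _ ?_
    (u := ⟨_, hlift u⟩) (v := ⟨_, hlift v⟩) ?_ ?_
  · rintro ⟨s, hs⟩ h
    have h1 : (Φ s).2 = 0 := hpol _ fun w => by
      have h2 : QuadraticMap.polar (extendForm Φ G) s (Φ.symm (x w, w)) = 0 := h ⟨_, hlift w⟩
      rwa [polar_extendForm, LinearEquiv.apply_symm_apply] at h2
    have h2 : (Φ s).1 = 0 := by rw [(mem_graphSolid Φ).1 hs, h1, map_zero]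
    exact Subtype.ext ((LinearEquiv.map_eq_zero_iff Φ).1 (Prod.ext h2 h1))
  · rw [LinearIndependent.pair_iff] at huv ⊢
    intro a b hab
    refine huv a b ?_
    have := congrArg (fun s : graphSolid Φ x => (Φ (s : V)).2) hab
    simpa using this
  · intro a b
    rw [QuadraticMap.comp_apply, extendForm_eq_zero_iff Φ hG]
    simp [hl a b, hxu, hxv]

/-- Conversely, a solid cutting out a hyperbolic quadric does not contain the nucleus `N`, since
the quadric has just one point on each line through `N`; and it contains a line of the quadric. -/
theorem exists_graphSolid_of_isHyperbolicQuadric {r : ℕ} (hV : finrank K V = r + 1) {N : V}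
    (hN : Φ N = (1, 0)) {G : QuadraticForm K U} {φ : U → K} (hG : ∀ u, G u = φ u ^ 2)
    {S : Submodule K V} (hS : finrank K S = r)
    (hyp : IsHyperbolicQuadric (sectionBy (quadricPoints (extendForm Φ G)) S)) :
    ∃ (x : Dual K U) (u v : U), S = graphSolid Φ x ∧ LinearIndependent K ![u, v] ∧
      IsLinearOn φ u v ∧ x u = φ u ∧ x v = φ v := by
  obtain ⟨Q, ⟨I⟩, hQ⟩ := hyp
  rw [sectionBy_quadricPoints] at hQ
  have hφ0 : φ 0 = 0 := by simpa using (hG 0).symm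
  have hzero : ∀ s : S, Q s = 0 ↔ (Φ (s : V)).1 = φ (Φ (s : V)).2 := by
    intro s
    rw [← extendForm_eq_zero_iff Φ hG]
    by_cases hs : s = 0
    · simp [hs]
    · rw [← mk_mem_quadricPoints Q s hs, ← hQ, mk_mem_quadricPoints]
      rfl
  have hI : ∀ y, Q (I.symm y) = y 0 * y 1 + y 2 * y 3 := by
    intro y
    have h := I.map_app (I.symm y)
    rw [I.apply_symm_apply] at h
    rw [← h]
    simp [hyperbolicForm]
  have hNS : N ∉ S := by
    intro hNS
    have hn : Q ⟨N, hNS⟩ ≠ 0 := by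
      rw [Ne, hzero]
      simp [hN, hφ0]
    -- no line through `N` contains two singular points
    have hpol : ∀ w, Q w = 0 → QuadraticMap.polar Q w ⟨N, hNS⟩ = 0 := by
      intro w hw
      set t := -(QuadraticMap.polar Q w ⟨N, hNS⟩ / Q ⟨N, hNS⟩) with ht
      have h1 : Q (w + t • ⟨N, hNS⟩) = 0 := by
        rw [QuadraticMap.map_add Q, QuadraticMap.map_smul, QuadraticMap.polar_smul_right, hw, ht]
        simp only [smul_eq_mul]
        field_simp
        ring
      rw [hzero] at h1 hw
      have ht0 : t = 0 := by simpa [hN, hw] using h1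
      rw [ht, neg_eq_zero, div_eq_zero_iff] at ht0
      exact ht0.resolve_right hn
    have hc : ∀ y, QuadraticMap.polar Q (I.symm y) ⟨N, hNS⟩ =
        y 0 * I ⟨N, hNS⟩ 1 + y 1 * I ⟨N, hNS⟩ 0 + y 2 * I ⟨N, hNS⟩ 3 + y 3 * I ⟨N, hNS⟩ 2 := by
      intro y
      have e1 : (⟨N, hNS⟩ : S) = I.symm (I ⟨N, hNS⟩) := (I.symm_apply_apply _).symm
      rw [QuadraticMap.polar]
      conv_lhs => rw [e1]
      rw [← map_add, hI, hI, hI]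
      simp only [Pi.add_apply]
      ring
    have hcoord : ∀ i, QuadraticMap.polar Q (I.symm (Pi.single i 1)) ⟨N, hNS⟩ = 0 := by
      intro i
      apply hpol
      rw [hI]
      fin_cases i <;> simp
    have hIN : I ⟨N, hNS⟩ = 0 := by
      funext i
      fin_cases i
      · simpa [hc] using hcoord 1
      · simpa [hc] using hcoord 0
      · simpa [hc] using hcoord 3
      · simpa [hc] using hcoord 2
    apply hn
    rw [← I.map_app, hIN, QuadraticMap.map_zero]
  obtain ⟨x, rfl⟩ := exists_eq_graphSolid Φ hV hN hS hNS
  have hmem : ∀ s : graphSolid Φ x, (Φ (s : V)).1 = x (Φ (s : V)).2 := fun s =>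
    (mem_graphSolid Φ).1 s.2
  set u : graphSolid Φ x := I.symm (Pi.single 0 1) with hu
  set v : graphSolid Φ x := I.symm (Pi.single 2 1) with hv
  have hab : ∀ a b : K, x (a • (Φ (u : V)).2 + b • (Φ (v : V)).2) =
      φ (a • (Φ (u : V)).2 + b • (Φ (v : V)).2) := by
    intro a b
    have h1 : Q (a • u + b • v) = 0 := by
      have : a • u + b • v = I.symm (a • Pi.single 0 1 + b • Pi.single 2 1) := by
        rw [hu, hv, map_add, map_smul, map_smul]
      rw [this, hI]
      simp
    rw [hzero, hmem] at h1
    simpa using h1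
  have hxu : x (Φ (u : V)).2 = φ (Φ (u : V)).2 := by simpa using hab 1 0
  have hxv : x (Φ (v : V)).2 = φ (Φ (v : V)).2 := by simpa using hab 0 1
  refine ⟨x, (Φ (u : V)).2, (Φ (v : V)).2, rfl, ?_, ?_, hxu, hxv⟩
  · rw [LinearIndependent.pair_iff]
    intro a b h0
    have h1 : a • u + b • v = 0 := by
      apply Subtype.ext
      apply (LinearEquiv.map_eq_zero_iff Φ).1
      have h2 : (Φ ((a • u + b • v : graphSolid Φ x) : V)).2 = 0 := by simpa using h0
      exact Prod.ext (by rw [hmem, h2, map_zero]; rfl) h2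
    have h2 := congrArg I h1
    rw [map_add, map_smul, map_smul, hu, hv, I.apply_symm_apply, I.apply_symm_apply,
      map_zero] at h2
    exact ⟨by simpa using congrFun h2 0, by simpa using congrFun h2 2⟩
  · intro a b
    rw [← hab, map_add, map_smul, map_smul, hxu, hxv, smul_eq_mul, smul_eq_mul]

end QuadricOfForm

end

/-! ### The characterization -/

theorem theorem1 (K : Type*) [Field K] [Finite K] (q : ℕ) (hq : q = Nat.card K) (hq_even : Even q)
    (H : Set (Submodule K (PG4Space K)))
    (hH_solid : ∀ S ∈ H, IsSolid S) (hH_nonempty : H.Nonempty)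
    (hI : ∀ P : ℙ K (PG4Space K),
      numContaining H P.submodule = 0 ∨
      2 * numContaining H P.submodule = q ^ 3 ∨
      2 * numContaining H P.submodule = q ^ 3 + q ^ 2)
    (hII : ∀ π : Submodule K (PG4Space K), IsPlane π → (∃ S ∈ H, π ≤ S) →
      q ≤ 2 * numContaining H π) :
    ∃ A : Set (ℙ K (PG4Space K)),
      A = {P | 2 * numContaining H P.submodule = q ^ 3 + q ^ 2} ∧
      IsNonsingularQuadric A ∧
      H = {S | IsSolid S ∧ IsHyperbolicQuadric (sectionBy A S)} := by
  classical
  have : Fintype K := Fintype.ofFinite K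
  have : Fintype (Module.Dual K (Fin 4 → K)) :=
    @Fintype.ofFinite _ (Module.finite_of_finite K)
  have hqK : Fintype.card K = q := by rw [hq, Nat.card_eq_fintype_card]
  have hchar : CharP K 2 := by
    rw [← FiniteField.even_card_iff_char_two.2 (by rw [hqK]; exact Nat.even_iff.1 hq_even)]
    infer_instance
  obtain ⟨e, -, hqe⟩ := FiniteField.card K 2
  have hnum := numContaining_span H
  have hV : Module.finrank K (PG4Space K) = 4 + 1 := by simp
  have hU : Module.finrank K (Fin 4 → K) = 4 := by simp
  have hI' : ∀ v : PG4Space K, v ≠ 0 →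
      2 * Finset.card {S ∈ H.toFinite.toFinset | v ∈ S} = 0 ∨
      2 * Finset.card {S ∈ H.toFinite.toFinset | v ∈ S} = q ^ 3 ∨
      2 * Finset.card {S ∈ H.toFinite.toFinset | v ∈ S} = q ^ 3 + q ^ 2 := by
    intro v hv
    have h := hI (Projectivization.mk K v hv)
    rw [Projectivization.submodule_mk, hnum] at h
    simpa using h
  obtain ⟨hcard, N, hN0, hN⟩ := card_solids e.pos hqe hV H.toFinite.toFinset
    (fun S hS => hH_solid S (by simpa using hS)) (by simpa using hH_nonempty)
    (by rw [hqK]; exact hI')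
  rw [hqK] at hcard
  have hNH : ∀ S ∈ H, N ∉ S := by
    intro S hS hNS
    rw [Finset.card_eq_zero, Finset.filter_eq_empty_iff] at hN
    exact hN (by simpa using hS) hNS
  obtain ⟨Φ, hΦ⟩ := exists_equiv_prod hV hN0
  obtain ⟨φ, hX⟩ := exists_isTwoIntersectionSet Φ hqK hU hΦ hH_solid hNH hcard hI' hII
  have hpolar : HasPolarPlanes φ := ⟨hX.map_smul, fun u hu => hX.exists_dual_isLinearOn_iff hu⟩
  obtain ⟨G, hG, hGpol⟩ := hpolar.exists_quadraticForm hU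
  have hqpos : 0 < q := hqK ▸ Fintype.card_pos
  -- the points on most solids are the zeros of `t² + G u`
  have hA : {P : ℙ K (PG4Space K) | 2 * numContaining H P.submodule = q ^ 3 + q ^ 2} =
      quadricPoints (extendForm Φ G) := by
    ext P
    induction P using Projectivization.ind with
    | h v hv =>
      rw [mk_mem_quadricPoints, extendForm_eq_zero_iff Φ hG, Set.mem_ofPred_eq,
        Projectivization.submodule_mk, hnum]
      have hv' : v = Φ.symm ((Φ v).1, (Φ v).2) := (Φ.symm_apply_apply v).symm
      by_cases hu : (Φ v).2 = 0
      · have ht : (Φ v).1 ≠ 0 := fun ht => hv ((LinearEquiv.map_eq_zero_iff Φ).1 (Prod.ext ht hu))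
        have hvN : v = (Φ v).1 • N := by
          apply Φ.injective
          rw [map_smul, hΦ]
          ext <;> simp [hu]
        have hempty : Finset.card {S ∈ H.toFinite.toFinset | v ∈ S} = 0 := by
          rw [Finset.card_eq_zero, Finset.filter_eq_empty_iff]
          intro S hS hvS
          rw [hvN, Submodule.smul_mem_iff _ ht] at hvS
          exact hNH S (by simpa using hS) hvS
        rw [hu, hX.map_zero, hempty]
        have : 0 < q ^ 2 := by positivity
        constructor
        · intro h; omega
        · intro h; exact absurd h ht
      · rw [← hX.card_apply_eq_iff hu, hqK]
        have := card_dualPoints_filter Φ hΦ hH_solid hNH (fun x => x (Φ v).2 = (Φ v).1)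
          (fun S => v ∈ S) (fun x => by rw [mem_graphSolid, eq_comm])
        rw [this]
  refine ⟨_, rfl, ⟨_, isNonsingularForm_extendForm Φ hGpol, hA⟩, ?_⟩
  rw [hA]
  ext S
  constructor
  · intro hS
    refine ⟨hH_solid S hS, ?_⟩
    obtain ⟨x, rfl⟩ := exists_eq_graphSolid Φ hV hΦ (hH_solid S hS) (hNH S hS)
    obtain ⟨u, v, huv, hl, hxu, hxv⟩ := hX.exists_isLinearOn_of_mem ((mem_dualPoints Φ).2 hS)
    exact isHyperbolicQuadric_graphSolid Φ hV hG hGpol huv hl hxu hxv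
  · rintro ⟨hS, hyp⟩
    obtain ⟨x, u, v, rfl, huv, hl, hxu, hxv⟩ :=
      exists_graphSolid_of_isHyperbolicQuadric Φ hV hΦ hG hS hyp
    exact (mem_dualPoints Φ).1 (hX.plane_subset_of_isLinearOn huv hl hxu hxv)
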